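/- Let $\mathbb F_q$ be a finite field. For a linear code $C\subseteq\mathbb F_q^n$ let $C^\perp=\{y\in\mathbb F_q^n \mid \sum_i x_iy_i=0 \text{ for all } x\in C\}$ be its dual, and let $\mathsf{Gr}(n,k)$ be the set of all $k$-dimensional linear subspaces of $\mathbb F_q^n$. For linear codes $C_1\subseteq\mathbb F_q^{n_1}$, $C_2\subseteq\mathbb F_q^{n_2}$ let $C_1\otimes C_2\subseteq\mathbb F_q^{n_1\times n_2}$ be the space of all matrices whose columns all lie in $C_1$ and whose rows all lie in $C_2$. Let $\delta(\cdot,\cdot)$ be the Hamming distance divided by the length (for $n_1\times n_2$ matrices, by $n_1n_2$), and $\delta(x,C)=\min_{c\in C}\delta(x,c)$. The code $C_1\otimes C_2$ is called $\rho$-robustly testable if for every $x\in\mathbb F_q^{n_1\times n_2}$ $$\rho\cdot\delta(x,C_1\otimes C_2)\le\tfrac12\bigl(\delta(x,C_1\otimes\mathbb F_q^{n_2})+\delta(x,\mathbb F_q^{n_1}\otimes C_2)\bigr).$$ Corollary 1 (two-sided robustness). For every $R_1,R_2\in(0,1)$ there exists $\rho>0$ such that for all sequences of integers $k_1=k_1(n)\ge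 0$, $k_2=k_2(n)\ge 0$ with $k_1/n\to R_1$ and $k_2/n\to R_2$ as $n\to\infty$, if a pair of codes $(C_1,C_2)$ is picked uniformly at random from $\mathsf{Gr}(n,k_1)\times\mathsf{Gr}(n,k_2)$, then the probability that both $C_1\otimes C_2$ and $C_1^\perp\otimes C_2^\perp$ are $\rho$-robustly testable tends to $1$ as $n\to\infty$. -/

import Mathlib

noncomputable section

open Filter Topology ProbabilityTheory

/-- The Grassmannian `Gr(n, k)`: all `k`-dimensional linear subspaces of `F ^ n`. -/
def Gr (F : Type*) [Field F] (n k : ℕ) : Set (Submodule F (Fin n → F)) :=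
  {C | Module.finrank F C = k}

/-- The dual code: all vectors orthogonal to `C` for the standard bilinear form `∑ i, x i * y i`. -/
def dualCode {F : Type*} [Field F] {n : ℕ} (C : Submodule F (Fin n → F)) :
    Submodule F (Fin n → F) :=
  C.orthogonalBilin (dotProductBilin F F)

theorem mem_dualCode {F : Type*} [Field F] {n : ℕ} {C : Submodule F (Fin n → F)}
    {y : Fin n → F} : y ∈ dualCode C ↔ ∀ x ∈ C, x ⬝ᵥ y = 0 :=
  Iff.rfl

/-- The product code `C₁ ⊗ C₂`: all `n₁ × n₂` matrices (functions of a row index and a column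
index) whose columns all lie in `C₁` and whose rows all lie in `C₂`. -/
def productCode {F : Type*} [Field F] {n₁ n₂ : ℕ}
    (C₁ : Submodule F (Fin n₁ → F)) (C₂ : Submodule F (Fin n₂ → F)) :
    Submodule F (Fin n₁ × Fin n₂ → F) where
  carrier := {c | (∀ j, (fun i => c (i, j)) ∈ C₁) ∧ (∀ i, (fun j => c (i, j)) ∈ C₂)}
  add_mem' ha hb := ⟨fun j => C₁.add_mem (ha.1 j) (hb.1 j), fun i => C₂.add_mem (ha.2 i) (hb.2 i)⟩
  zero_mem' := ⟨fun _ => C₁.zero_mem, fun _ => C₂.zero_mem⟩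
  smul_mem' a _ hc := ⟨fun j => C₁.smul_mem a (hc.1 j), fun i => C₂.smul_mem a (hc.2 i)⟩

open Classical in
/-- The normalized Hamming distance `δ(x, y)`: the fraction of coordinates where `x, y` differ. -/
def relDist {F ι : Type*} [Fintype ι] (x y : ι → F) : ℝ :=
  (hammingDist x y : ℝ) / Fintype.card ι

/-- The distance `δ(x, C) = min_{c ∈ C} δ(x, c)` from a word to a linear code. -/
def relDistTo {F ι : Type*} [Field F] [Fintype ι] (x : ι → F) (C : Submodule F (ι → F)) : ℝ :=
  ⨅ c : C, relDist x (c : ι → F)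

/-- The product code `C₁ ⊗ C₂` is `ρ`-robustly testable. Here `productCode C₁ ⊤` is `C₁ ⊗ F ^ n₂`
(all columns in `C₁`) and `productCode ⊤ C₂` is `F ^ n₁ ⊗ C₂` (all rows in `C₂`). -/
def IsRobustlyTestable {F : Type*} [Field F] {n₁ n₂ : ℕ} (ρ : ℝ)
    (C₁ : Submodule F (Fin n₁ → F)) (C₂ : Submodule F (Fin n₂ → F)) : Prop :=
  ∀ x : Fin n₁ × Fin n₂ → F,
    ρ * relDistTo x (productCode C₁ C₂) ≤
      (1 / 2) * (relDistTo x (productCode C₁ ⊤) + relDistTo x (productCode ⊤ C₂))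

/-- The set of subspaces of `F ^ n` carries the discrete σ-algebra. -/
instance instMeasurableSpaceCode {F : Type*} [Field F] {n : ℕ} :
    MeasurableSpace (Submodule F (Fin n → F)) := ⊤

instance instDiscreteMeasurableSpaceCode {F : Type*} [Field F] {n : ℕ} :
    DiscreteMeasurableSpace (Submodule F (Fin n → F)) :=
  ⟨fun _ => MeasurableSpace.measurableSet_top⟩

end

/-! Let `a` have columns in C₁ and `b` rows in C₂, both nearest to a word x, with total distance W.
If W exceeds α²n², the zero codeword already suffices. Otherwise at most αn rows B₁ and αn columns
B₂ of `a - b` have weight above αn; deleting them leaves a light matrix X. Suppose X = 0. As C₁ has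
no nonzero word supported on B₁, decoding the columns of `b` in C₁ with B₁ erased gives a product
codeword equal to `a` off the columns B₂, hence at distance O(W) from x. This is
`isRobustlyTestable_of_spreadsLight`; its hypothesis `¬ HasLightSum` is what forces X = 0.

Two union bounds show that the hypotheses hold for most pairs. Both rest on
`ncard_gr_containing_le`, and both use that the number Λ of light vectors is at most q^(εn), with ε
as small as desired once α is small. For `SpreadsLight`: if it fails for r light vectors, at least
half of them can be corrected, by fewer than cr of the others and by vectors on B, to independent
codewords of C. The choices are too few to offset the small probability of containing all these
words (`ncard_not_spreadsLight_le`). For `HasLightSum`: a light X of rank r is determined by r rows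
and r columns, so there are at most (nΛ)^(2r) of them. If C₁ spreads light vectors, at least cr dual
words f give independent vectors fX, each forced into C₂ up to coordinates in B₂. For random C₂ this
has probability at most (Λ q^(-(n-k)))^(cr) (`ncard_hasLightSum_le`).

The argument needs only codimensions linear in n. Duality is a bijection of Grassmannians, so the
same bound applied to the dual rates covers the dual pair. -/

/-! ### Union bound and containment probabilities for a uniform subspace -/

theorem ncard_le_card_mul_of_cover {α ι : Type*} [Finite α] [Finite ι] {S : Set α}
    (T : ι → Set α) (h : ∀ a ∈ S, ∃ i, a ∈ T i) {M : ℝ} (hM : ∀ i, ((T i).ncard : ℝ) ≤ M) :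
    (S.ncard : ℝ) ≤ Nat.card ι * M := by
  classical
  cases nonempty_fintype ι
  have h1 : S ⊆ ⋃ i, T i := fun a ha => Set.mem_iUnion.2 (h a ha)
  have h2 : S.ncard ≤ ∑ i, (T i).ncard := by
    refine (Set.ncard_le_ncard h1 (Set.toFinite _)).trans ?_
    have := Set.ncard_iUnion_le_of_fintype T
    simpa using this
  calc (S.ncard : ℝ) ≤ ∑ i, ((T i).ncard : ℝ) := by exact_mod_cast h2
    _ ≤ ∑ _i : ι, M := Finset.sum_le_sum fun i _ => hM i
    _ = Nat.card ι * M := by simp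

/-- The general linear group acts transitively on linearly independent families. -/
theorem exists_linearEquiv_apply_eq {K V ι : Type*} [Field K] [AddCommGroup V] [Module K V]
    [FiniteDimensional K V] {v w : ι → V} (hv : LinearIndependent K v)
    (hw : LinearIndependent K w) : ∃ e : V ≃ₗ[K] V, ∀ i, e (v i) = w i := by
  let f : Submodule.span K (Set.range v) ≃ₗ[K] Submodule.span K (Set.range w) :=
    (Module.Basis.span hv).equiv (Module.Basis.span hw) (Equiv.refl ι)
  obtain ⟨e, he⟩ := Submodule.exists_linearEquiv_restrict_eq f
  refine ⟨e, fun i => ?_⟩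
  have h1 := he (Module.Basis.span hv i)
  rw [Module.Basis.equiv_apply, Module.Basis.span_apply, Module.Basis.span_apply] at h1
  exact h1.symm

theorem ncard_gr_containing_eq {F ι : Type*} [Field F] {n k : ℕ}
    {v w : ι → Fin n → F} (hv : LinearIndependent F v) (hw : LinearIndependent F w) :
    {C | C ∈ Gr F n k ∧ ∀ i, v i ∈ C}.ncard = {C | C ∈ Gr F n k ∧ ∀ i, w i ∈ C}.ncard := by
  obtain ⟨e, he⟩ := exists_linearEquiv_apply_eq hv hw
  refine Set.ncard_congr (fun C _ => C.map (e : (Fin n → F) →ₗ[F] (Fin n → F))) ?_ ?_ ?_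
  · rintro C ⟨hC, hCv⟩
    refine ⟨?_, fun i => ⟨v i, hCv i, he i⟩⟩
    simp only [Gr, Set.mem_ofPred_eq] at hC ⊢
    rw [← hC]
    exact LinearEquiv.finrank_map_eq e C
  · intro C D _ _ h
    exact Submodule.map_injective_of_injective e.injective h
  · rintro C ⟨hC, hCw⟩
    refine ⟨C.map (e.symm : (Fin n → F) →ₗ[F] (Fin n → F)), ⟨?_, fun i => ⟨w i, hCw i, ?_⟩⟩, ?_⟩
    · simp only [Gr, Set.mem_ofPred_eq] at hC ⊢
      rw [← hC]
      exact LinearEquiv.finrank_map_eq e.symm C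
    · rw [← he i]; simp
    · rw [← Submodule.map_comp]; simp

/-- Double counting of pairs (independent s-family, code containing it): by transitivity of the
linear group every family lies in equally many codes, and each code contains at most a fraction
q^(-(n-k)s) of all independent families. -/
theorem ncard_gr_containing_fin_mul_le {F : Type*} [Field F] [Finite F] {n k s : ℕ}
    (hk : k ≤ n) {v : Fin s → Fin n → F} (hv : LinearIndependent F v) :
    {C | C ∈ Gr F n k ∧ ∀ i, v i ∈ C}.ncard * Nat.card F ^ ((n - k) * s)
      ≤ (Gr F n k).ncard := by
  classical
  cases nonempty_fintype F
  simp only [Nat.card_eq_fintype_card]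
  set N := {C | C ∈ Gr F n k ∧ ∀ i, v i ∈ C}.ncard with hN
  have hs : s ≤ n := by simpa using hv.fintype_card_le_finrank
  let e : (Σ w : {w : Fin s → Fin n → F // LinearIndependent F w},
        {C // C ∈ Gr F n k ∧ ∀ i, w.1 i ∈ C}) ≃
      Σ C : Gr F n k, {w : Fin s → C.1 // LinearIndependent F w} :=
    { toFun := fun p => ⟨⟨p.2.1, p.2.2.1⟩, ⟨fun i => ⟨p.1.1 i, p.2.2.2 i⟩,
        LinearIndependent.of_comp p.2.1.subtype p.1.2⟩⟩
      invFun := fun p => ⟨⟨fun i => p.2.1 i, p.2.2.map' p.1.1.subtype (by simp)⟩,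
        ⟨p.1.1, p.1.2, fun i => (p.2.1 i).2⟩⟩
      left_inv := fun p => rfl
      right_inv := fun p => rfl }
  have h1 := Nat.card_congr e
  rw [Nat.card_sigma, Nat.card_sigma] at h1
  have h2 : ∀ w : {w : Fin s → Fin n → F // LinearIndependent F w},
      Nat.card {C // C ∈ Gr F n k ∧ ∀ i, w.1 i ∈ C} = N := fun w => by
    rw [hN, ncard_gr_containing_eq hv w.2]; rfl
  rw [Finset.sum_congr rfl fun w _ => h2 w, Finset.sum_const, Finset.card_univ,
    ← Nat.card_eq_fintype_card, card_linearIndependent (by simpa using hs)] at h1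
  simp only [Module.finrank_fintype_fun_eq_card, Fintype.card_fin, smul_eq_mul] at h1
  set q := Fintype.card F
  have hq : 1 < q := Fintype.one_lt_card
  have hpos : 0 < ∏ i : Fin s, (q ^ n - q ^ (i : ℕ)) :=
    Finset.prod_pos fun i _ => Nat.sub_pos_of_lt (Nat.pow_lt_pow_right hq (by omega))
  have h3 : ∀ C : Gr F n k, Nat.card {w : Fin s → C.1 // LinearIndependent F w} *
      q ^ ((n - k) * s) ≤ ∏ i : Fin s, (q ^ n - q ^ (i : ℕ)) := by
    rintro ⟨C, hC⟩
    change Module.finrank F C = k at hC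
    by_cases hsk : s ≤ k
    · rw [card_linearIndependent (by rw [hC]; exact hsk), hC, pow_mul,
        show (q ^ (n - k)) ^ s = ∏ _i : Fin s, q ^ (n - k) by simp, ← Finset.prod_mul_distrib]
      -- Factor by factor, (q^k - q^i) q^(n-k) ≤ q^n - q^i.
      refine Finset.prod_le_prod' fun i _ => ?_
      change (q ^ k - q ^ (i : ℕ)) * q ^ (n - k) ≤ _
      rw [Nat.sub_mul, ← pow_add, Nat.add_sub_cancel' hk]
      exact Nat.sub_le_sub_left (Nat.le_mul_of_pos_right _ (by positivity)) _
    · have : IsEmpty {w : Fin s → C // LinearIndependent F w} := ⟨fun w => hsk <| by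
        simpa [hC] using w.2.fintype_card_le_finrank⟩
      simp
  refine Nat.le_of_mul_le_mul_left ?_ hpos
  rw [← mul_assoc, h1, Finset.sum_mul]
  refine (Finset.sum_le_sum fun C _ => h3 C).trans ?_
  rw [Finset.sum_const, Finset.card_univ, smul_eq_mul, mul_comm, ← Nat.card_eq_fintype_card]
  rfl

/-- A uniformly random `k`-dimensional code contains `s` given linearly independent vectors with
probability at most `q ^ (-(n - k) s)`. -/
theorem ncard_gr_containing_le {F ι : Type*} [Field F] [Finite F] [Fintype ι] {n k : ℕ}
    (hk : k ≤ n) {v : ι → Fin n → F} (hv : LinearIndependent F v) :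
    ({C | C ∈ Gr F n k ∧ ∀ i, v i ∈ C}.ncard : ℝ) ≤
      (((Nat.card F : ℝ) ^ (n - k))⁻¹) ^ Fintype.card ι * (Gr F n k).ncard := by
  have h := ncard_gr_containing_fin_mul_le hk (hv.comp _ (Fintype.equivFin ι).symm.injective)
  rw [show {C | C ∈ Gr F n k ∧ ∀ i, (v ∘ (Fintype.equivFin ι).symm) i ∈ C} =
    {C | C ∈ Gr F n k ∧ ∀ i, v i ∈ C} from Set.ext fun C => and_congr_right fun _ =>
      (Fintype.equivFin ι).symm.forall_congr_right (q := fun i => v i ∈ C)] at h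
  have hq : (0 : ℝ) < Nat.card F := by exact_mod_cast Nat.card_pos
  have h' : ({C | C ∈ Gr F n k ∧ ∀ i, v i ∈ C}.ncard : ℝ) *
      (Nat.card F : ℝ) ^ ((n - k) * Fintype.card ι) ≤ (Gr F n k).ncard := by exact_mod_cast h
  rw [inv_pow, ← pow_mul, inv_mul_eq_div, le_div_iff₀ (by positivity)]
  exact h'

/-! ### Dual families of functionals -/

/-- Linear functionals `φ` on `E` contain a subfamily `J` with a dual family in `E`, which spans
all the others on `E`. -/
theorem exists_dual_family {K V ι : Type*} [Field K] [AddCommGroup V] [Module K V] [Finite ι]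
    [DecidableEq ι] (E : Submodule K V) (φ : ι → V →ₗ[K] K) :
    ∃ (J : Finset ι) (f : ι → V),
      (∀ j ∈ J, f j ∈ E ∧ ∀ i ∈ J, φ i (f j) = if i = j then 1 else 0) ∧
      ∀ i ∉ J, ∃ a : J → K, ∀ g ∈ E, φ i g = ∑ j : J, a j * φ j g := by
  have hne : {J : Finset ι | ∃ f : ι → V, ∀ j ∈ J, f j ∈ E ∧
      ∀ i ∈ J, φ i (f j) = if i = j then 1 else 0}.Nonempty := ⟨∅, 0, by simp⟩
  have := Fintype.ofFinite ι
  obtain ⟨J, ⟨f, hf⟩, hmax⟩ := (Set.toFinite _).exists_maximal hne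
  refine ⟨J, f, hf, fun i hi => ⟨fun j => φ i (f j), fun g hg => ?_⟩⟩
  by_contra hne
  -- Subtracting the component of g along the dual family kills every functional in J; if `φ i`
  -- survives on g', the normalised g' extends the dual family to `insert i J`, against maximality.
  set g' := g - ∑ j ∈ J, φ j g • f j with hg'
  have hg'E : g' ∈ E := E.sub_mem hg (E.sum_mem fun j hj => E.smul_mem _ (hf j hj).1)
  have hJ : ∀ l ∈ J, φ l g' = 0 := fun l hl => by
    rw [hg', map_sub, map_sum, Finset.sum_congr rfl fun j hj => by
      rw [map_smul, (hf j hj).2 l hl]]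
    simp [hl]
  have hi' : φ i g' ≠ 0 := fun h0 => hne <| by
    rw [hg', map_sub, map_sum, sub_eq_zero] at h0
    rw [h0, ← Finset.sum_coe_sort J]
    simp [mul_comm]
  set h := (φ i g')⁻¹ • g' with hh
  have hhE : h ∈ E := E.smul_mem _ hg'E
  have hhi : φ i h = 1 := by simp [hh, hi']
  have hhJ : ∀ l ∈ J, φ l h = 0 := fun l hl => by simp [hh, hJ l hl]
  have hmem : insert i J ∈ {J : Finset ι | ∃ f : ι → V, ∀ j ∈ J, f j ∈ E ∧
      ∀ i ∈ J, φ i (f j) = if i = j then 1 else 0} := by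
    refine ⟨fun j => if j = i then h else f j - φ i (f j) • h, fun j hj => ⟨?_, fun l hl => ?_⟩⟩
    · by_cases hji : j = i
      · simpa [hji] using hhE
      · have hjJ := (Finset.mem_insert.1 hj).resolve_left hji
        simpa [hji] using E.sub_mem (hf j hjJ).1 (E.smul_mem _ hhE)
    · by_cases hji : j = i
      · subst hji
        rcases Finset.mem_insert.1 hl with rfl | hl
        · simpa using hhi
        · have : l ≠ j := fun h => hi (h ▸ hl)
          simpa [this] using hhJ l hl
      · have hjJ := (Finset.mem_insert.1 hj).resolve_left hji
        rcases Finset.mem_insert.1 hl with rfl | hl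
        · simp [hji, hhi, Ne.symm hji]
        · simpa [hji, hhJ l hl] using (hf j hjJ).2 l hl
  exact hi (hmax hmem (Finset.subset_insert i J) (Finset.mem_insert_self i J))

/-! ### Weights, coordinate subspaces, duality and puncturing -/

open scoped Classical in
/-- The Hamming weight. -/
noncomputable def weight {F ι : Type*} [Field F] [Fintype ι] (v : ι → F) : ℕ :=
  hammingNorm v

/-- Vectors of `F ^ n` supported on `B`. -/
def supportedOn (F : Type*) [Field F] {n : ℕ} (B : Finset (Fin n)) : Submodule F (Fin n → F) where
  carrier := {v | ∀ i ∉ B, v i = 0}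
  add_mem' ha hb i hi := by simp [ha i hi, hb i hi]
  zero_mem' _ _ := rfl
  smul_mem' a v hv i hi := by simp [hv i hi]

theorem mem_supportedOn {F : Type*} [Field F] {n : ℕ} {B : Finset (Fin n)} {v : Fin n → F} :
    v ∈ supportedOn F B ↔ ∀ i ∉ B, v i = 0 := Iff.rfl

theorem mem_supportedOn_compl {F : Type*} [Field F] {n : ℕ} {B : Finset (Fin n)} {v : Fin n → F} :
    v ∈ supportedOn F Bᶜ ↔ ∀ i ∈ B, v i = 0 := by
  simp [mem_supportedOn]

theorem weight_le_card {F : Type*} [Field F] {n : ℕ} {B : Finset (Fin n)} {v : Fin n → F}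
    (hv : v ∈ supportedOn F B) : weight v ≤ B.card := by
  classical
  unfold weight hammingNorm
  refine Finset.card_le_card fun i hi => ?_
  by_contra h
  simp [hv i h] at hi

theorem isRefl_dotProductBilin (F : Type*) [Field F] (n : ℕ) :
    (dotProductBilin F F : (Fin n → F) →ₗ[F] (Fin n → F) →ₗ[F] F).IsRefl := fun x y h => by
  change y ⬝ᵥ x = 0
  rw [dotProduct_comm]; exact h

theorem nondegenerate_dotProductBilin (F : Type*) [Field F] (n : ℕ) :
    LinearMap.BilinForm.Nondegenerate
      (dotProductBilin F F : LinearMap.BilinForm F (Fin n → F)) := by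
  refine ⟨fun x h => dotProduct_eq_zero x h, fun x h => dotProduct_eq_zero x fun w => ?_⟩
  rw [dotProduct_comm]; exact h w

theorem dualCode_dualCode {F : Type*} [Field F] {n : ℕ} (C : Submodule F (Fin n → F)) :
    dualCode (dualCode C) = C :=
  LinearMap.BilinForm.orthogonal_orthogonal (nondegenerate_dotProductBilin F n)
    (isRefl_dotProductBilin F n) C

theorem finrank_dualCode {F : Type*} [Field F] {n : ℕ} (C : Submodule F (Fin n → F)) :
    Module.finrank F (dualCode C) = n - Module.finrank F C := by
  have := LinearMap.BilinForm.finrank_orthogonal (nondegenerate_dotProductBilin F n) C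
  rw [Module.finrank_fintype_fun_eq_card, Fintype.card_fin] at this
  exact this

/-- Puncturing: setting the coordinates in `B` to zero. -/
def puncture (F : Type*) [Field F] {n : ℕ} (B : Finset (Fin n)) :
    (Fin n → F) →ₗ[F] (Fin n → F) where
  toFun v i := if i ∈ B then 0 else v i
  map_add' v w := by ext i; by_cases h : i ∈ B <;> simp [h]
  map_smul' a v := by ext i; by_cases h : i ∈ B <;> simp [h]

theorem puncture_apply {F : Type*} [Field F] {n : ℕ} (B : Finset (Fin n)) (v : Fin n → F)
    (i : Fin n) : puncture F B v i = if i ∈ B then 0 else v i := rfl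

theorem puncture_eq_zero {F : Type*} [Field F] {n : ℕ} {B : Finset (Fin n)} {v : Fin n → F}
    (h : v ∈ supportedOn F B) : puncture F B v = 0 := by
  ext i
  by_cases hi : i ∈ B
  · simp [puncture_apply, hi]
  · simp [puncture_apply, hi, h i hi]

theorem puncture_eq_self {F : Type*} [Field F] {n : ℕ} {B : Finset (Fin n)} {v : Fin n → F}
    (h : v ∈ supportedOn F Bᶜ) : puncture F B v = v := by
  ext i
  by_cases hi : i ∈ B
  · simp [puncture_apply, hi, mem_supportedOn_compl.1 h i hi]
  · simp [puncture_apply, hi]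

/-- Perturbing a linearly independent family, off a subfamily `J`, by combinations of that
subfamily and by vectors on the complementary coordinates keeps it linearly independent. -/
theorem linearIndependent_sub_sub {F ι : Type*} [Field F] {n : ℕ} {B : Finset (Fin n)}
    {u : ι → Fin n → F} (hu : LinearIndependent F u) (huB : ∀ i, u i ∈ supportedOn F Bᶜ)
    (J : Finset ι) (a : {i // i ∉ J} → J → F) (w : {i // i ∉ J} → Fin n → F)
    (hw : ∀ i, w i ∈ supportedOn F B) :
    LinearIndependent F
      (fun i : {i // i ∉ J} => u i - ∑ j : J, a i j • u j - w i) := by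
  set S := Submodule.span F (u '' (J : Set ι))
  -- Puncturing at B removes the w's, and the quotient by the span of the u's in J removes the
  -- combinations; the remaining u's stay independent there.
  refine LinearIndependent.of_comp (S.mkQ ∘ₗ puncture F B) ?_
  have h1 : (S.mkQ ∘ₗ puncture F B) ∘ (fun i : {i // i ∉ J} => u i - ∑ j : J, a i j • u j - w i)
      = S.mkQ ∘ (fun i : {i // i ∉ J} => u i) := by
    funext i
    simp only [Function.comp_apply, LinearMap.comp_apply, map_sub, puncture_eq_zero (hw i),
      map_zero, sub_zero, map_sum, map_smul, puncture_eq_self (huB _)]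
    rw [sub_eq_self]
    refine Finset.sum_eq_zero fun j _ => ?_
    have : S.mkQ (u j) = 0 := by
      rw [Submodule.mkQ_apply, Submodule.Quotient.mk_eq_zero]
      exact Submodule.subset_span ⟨j, j.2, rfl⟩
    rw [this, smul_zero]
  rw [h1]
  refine (hu.comp _ Subtype.val_injective).map ?_
  rw [Submodule.ker_mkQ, Set.range_comp]
  refine hu.disjoint_span_image (Set.disjoint_left.2 ?_)
  rintro _ ⟨i, rfl⟩ hj
  exact i.2 hj

theorem dualCode_supportedOn {F : Type*} [Field F] {n : ℕ} (B : Finset (Fin n)) :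
    dualCode (supportedOn F B) = supportedOn F Bᶜ := by
  classical
  ext y
  rw [mem_dualCode, mem_supportedOn_compl]
  constructor
  · intro h i hi
    have := h (Pi.single i 1) fun j hj => by
      have : j ≠ i := fun h => hj (h ▸ hi)
      simp [this]
    simpa using this
  · intro h x hx
    refine Finset.sum_eq_zero fun i _ => ?_
    by_cases hi : i ∈ B
    · simp [h i hi]
    · simp [hx i hi]

theorem dualCode_sup {F : Type*} [Field F] {n : ℕ} (C D : Submodule F (Fin n → F)) :
    dualCode (C ⊔ D) = dualCode C ⊓ dualCode D := by
  ext y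
  simp only [Submodule.mem_inf, mem_dualCode]
  constructor
  · exact fun h => ⟨fun x hx => h x (Submodule.mem_sup_left hx),
      fun x hx => h x (Submodule.mem_sup_right hx)⟩
  · rintro ⟨h1, h2⟩ x hx
    obtain ⟨a, ha, b, hb, rfl⟩ := Submodule.mem_sup.1 hx
    rw [add_dotProduct, h1 a ha, h2 b hb, add_zero]

/-- A vector orthogonal to all dual codewords vanishing on `B` agrees with a codeword off `B`. -/
theorem mem_sup_supportedOn {F : Type*} [Field F] {n : ℕ} {C : Submodule F (Fin n → F)}
    {B : Finset (Fin n)} {v : Fin n → F}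
    (h : ∀ g ∈ dualCode C ⊓ supportedOn F Bᶜ, g ⬝ᵥ v = 0) : v ∈ C ⊔ supportedOn F B := by
  rw [← dualCode_dualCode (C ⊔ _), dualCode_sup, dualCode_supportedOn]
  exact h

/-! ### Random codes spread light vectors -/

/-- Light linearly independent vectors stay `c`-proportionally independent modulo the code and up
to the coordinates in any small set `B`. -/
def SpreadsLight {F : Type*} [Field F] {n : ℕ} (m : ℕ) (c : ℝ)
    (C : Submodule F (Fin n → F)) : Prop :=
  ∀ B : Finset (Fin n), B.card ≤ m → ∀ (r : ℕ) (u : Fin r → Fin n → F), LinearIndependent F u →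
    (∀ i, weight (u i) ≤ m) → (∀ i, u i ∈ supportedOn F Bᶜ) →
    ∃ J : Finset (Fin r), c * r ≤ J.card ∧ ∃ f : Fin r → Fin n → F,
      ∀ j ∈ J, f j ∈ dualCode C ⊓ supportedOn F Bᶜ ∧
        ∀ i ∈ J, f j ⬝ᵥ u i = if i = j then 1 else 0

/-- The witness that a code does not spread light vectors. -/
theorem exists_of_not_spreadsLight {F : Type*} [Field F] {n m : ℕ} {c : ℝ}
    {C : Submodule F (Fin n → F)} (h : ¬ SpreadsLight m c C) :
    ∃ r, 0 < r ∧ r ≤ n ∧ ∃ J : Finset (Fin r), (J.card : ℝ) < c * r ∧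
      ∃ u : Fin r → {v : Fin n → F // weight v ≤ m},
      ∃ a : {i // i ∉ J} → J → F, ∃ w : {i // i ∉ J} → {v : Fin n → F // weight v ≤ m},
        LinearIndependent F
          (fun i : {i // i ∉ J} => (u i : Fin n → F) - ∑ j : J, a i j • (u j).1 - (w i).1) ∧
        ∀ i : {i // i ∉ J}, (u i : Fin n → F) - ∑ j : J, a i j • (u j).1 - (w i).1 ∈ C := by
  classical
  unfold SpreadsLight at h
  push Not at h
  obtain ⟨B, hB, r, u, hu, hum, huB, h⟩ := h
  -- Pairing with `u i` is viewed as a functional on the dual words vanishing on B. The dual family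
  -- has fewer than cr members, and every other functional is a combination of those in J, which by
  -- biduality is a relation modulo C and vectors on B.
  obtain ⟨J, f, hf, ha⟩ := exists_dual_family (dualCode C ⊓ supportedOn F Bᶜ)
    (fun i => dotProductBilin F F (u i))
  have hJ : (J.card : ℝ) < c * r := by
    by_contra hJ
    obtain ⟨j, hj, hj'⟩ := h J (not_lt.1 hJ) f
    obtain ⟨i, hi, hne⟩ := hj' (hf j hj).1
    refine hne ?_
    rw [dotProduct_comm]
    exact (hf j hj).2 i hi
  have ha' : ∀ i : {i // i ∉ J}, ∃ a : J → F, ∃ w ∈ supportedOn F B,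
      u i - ∑ j : J, a j • u j - w ∈ C := by
    intro i
    obtain ⟨a, ha⟩ := ha i i.2
    have hmem : u i - ∑ j : J, a j • u j ∈ C ⊔ supportedOn F B := by
      refine mem_sup_supportedOn fun g hg => ?_
      have h1 : u i ⬝ᵥ g = ∑ j : J, a j * (u j ⬝ᵥ g) := ha g hg
      rw [dotProduct_comm, sub_dotProduct, h1, sum_dotProduct]
      simp [smul_dotProduct]
    obtain ⟨x, hx, w, hw, hxw⟩ := Submodule.mem_sup.1 hmem
    exact ⟨a, w, hw, by rw [← hxw, add_sub_cancel_right]; exact hx⟩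
  choose a w hw hC using ha'
  have hr : 0 < r := by
    rcases Nat.eq_zero_or_pos r with rfl | h
    · exfalso
      have : (0 : ℝ) ≤ J.card := by positivity
      simp at hJ
      linarith
    · exact h
  refine ⟨r, hr, by simpa using hu.fintype_card_le_finrank, J, hJ,
    fun i => ⟨u i, hum i⟩, a, fun i => ⟨w i, (weight_le_card (hw i)).trans hB⟩,
    linearIndependent_sub_sub hu huB J a w hw, hC⟩

/-- The number of vectors of length `n` and weight at most `m`. -/
noncomputable def numLight (F : Type*) [Field F] (n m : ℕ) : ℕ :=
  Nat.card {v : Fin n → F // weight v ≤ m}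

theorem one_le_numLight (F : Type*) [Field F] [Finite F] (n m : ℕ) : 1 ≤ numLight F n m := by
  have : Nonempty {v : Fin n → F // weight v ≤ m} := ⟨0, by simp [weight]⟩
  exact Nat.card_pos

/-- The union bound over the witnesses with a fixed index set `J`. -/
theorem ncard_not_spreadsLight_aux {F : Type*} [Field F] [Finite F] {n k m r : ℕ} (hk : k ≤ n)
    (J : Finset (Fin r)) :
    ({C | C ∈ Gr F n k ∧ ∃ u : Fin r → {v : Fin n → F // weight v ≤ m},
      ∃ a : {i // i ∉ J} → J → F, ∃ w : {i // i ∉ J} → {v : Fin n → F // weight v ≤ m},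
        LinearIndependent F
          (fun i : {i // i ∉ J} => (u i : Fin n → F) - ∑ j : J, a i j • (u j).1 - (w i).1) ∧
        ∀ i : {i // i ∉ J},
          (u i : Fin n → F) - ∑ j : J, a i j • (u j).1 - (w i).1 ∈ C}.ncard : ℝ) ≤
      (numLight F n m : ℝ) ^ r * ((Nat.card F : ℝ) ^ J.card * numLight F n m *
        ((Nat.card F : ℝ) ^ (n - k))⁻¹) ^ (r - J.card) * (Gr F n k).ncard := by
  classical
  have hs : Fintype.card {i // i ∉ J} = r - J.card := by
    rw [Fintype.card_subtype_compl, Fintype.card_fin, Fintype.card_coe]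
  refine (ncard_le_card_mul_of_cover
    (ι := (Fin r → {v : Fin n → F // weight v ≤ m}) × ({i // i ∉ J} → J → F) ×
      ({i // i ∉ J} → {v : Fin n → F // weight v ≤ m}))
    (fun p => {C | C ∈ Gr F n k ∧ LinearIndependent F (fun i : {i // i ∉ J} =>
        (p.1 i : Fin n → F) - ∑ j : J, p.2.1 i j • (p.1 j).1 - (p.2.2 i).1) ∧
        ∀ i : {i // i ∉ J},
          (p.1 i : Fin n → F) - ∑ j : J, p.2.1 i j • (p.1 j).1 - (p.2.2 i).1 ∈ C})
    ?_ (M := ((((Nat.card F : ℝ) ^ (n - k))⁻¹) ^ (r - J.card) * (Gr F n k).ncard)) ?_).trans ?_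
  · rintro C ⟨hC, u, a, w, hli, hmem⟩
    exact ⟨(u, a, w), hC, hli, hmem⟩
  · rintro ⟨u, a, w⟩
    by_cases hli : LinearIndependent F (fun i : {i // i ∉ J} =>
        (u i : Fin n → F) - ∑ j : J, a i j • (u j).1 - (w i).1)
    · have := ncard_gr_containing_le hk hli
      rw [hs] at this
      simpa only [hli, true_and] using this
    · simp only [hli, false_and, and_false, Set.ofPred_false, Set.ncard_empty, Nat.cast_zero]
      positivity
  · rw [Nat.card_prod, Nat.card_prod, Nat.card_fun, Nat.card_fun, Nat.card_fun, Nat.card_fun,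
      Nat.card_eq_fintype_card (α := {i // i ∉ J}), hs, Nat.card_eq_fintype_card (α := J),
      Fintype.card_coe, Nat.card_fin]
    change ((numLight F n m ^ r * ((Nat.card F ^ J.card) ^ (r - J.card) *
      numLight F n m ^ (r - J.card)) : ℕ) : ℝ) * _ ≤ _
    push_cast
    rw [mul_pow, mul_pow]
    exact le_of_eq (by ring)

/-- Most codes spread light vectors. -/
theorem ncard_not_spreadsLight_le {F : Type*} [Field F] [Finite F] {n k m T : ℕ} {c : ℝ}
    (hk : k ≤ n) (hc : c ≤ 1 / 2) (hc0 : 0 ≤ c) (hT : c * n ≤ T)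
    (hb : 4 * (numLight F n m : ℝ) ^ 3 * (Nat.card F : ℝ) ^ T *
      ((Nat.card F : ℝ) ^ (n - k))⁻¹ ≤ 1) :
    ({C | C ∈ Gr F n k ∧ ¬ SpreadsLight m c C}.ncard : ℝ) ≤
      n * (4 * (numLight F n m : ℝ) ^ 3 * (Nat.card F : ℝ) ^ T *
        ((Nat.card F : ℝ) ^ (n - k))⁻¹ * (Gr F n k).ncard) := by
  classical
  set Λ : ℝ := (numLight F n m : ℝ) with hΛ
  set q : ℝ := (Nat.card F : ℝ) with hq
  set b := 4 * Λ ^ 3 * q ^ T * (q ^ (n - k))⁻¹ with hbdef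
  have hΛ1 : 1 ≤ Λ := by rw [hΛ]; exact_mod_cast one_le_numLight F n m
  have hq1 : 1 ≤ q := by rw [hq]; exact_mod_cast Nat.succ_le_of_lt (Nat.card_pos (α := F))
  have hb0 : 0 ≤ b := by positivity
  -- The index r in `Fin n` stands for a family of size r + 1, since sizes range over 1, …, n.
  refine (ncard_le_card_mul_of_cover (ι := Fin n)
    (fun r => {C | C ∈ Gr F n k ∧ ∃ J : Finset (Fin (r + 1)), (J.card : ℝ) < c * (r + 1 : ℕ) ∧
      ∃ u : Fin (r + 1) → {v : Fin n → F // weight v ≤ m},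
      ∃ a : {i // i ∉ J} → J → F, ∃ w : {i // i ∉ J} → {v : Fin n → F // weight v ≤ m},
        LinearIndependent F
          (fun i : {i // i ∉ J} => (u i : Fin n → F) - ∑ j : J, a i j • (u j).1 - (w i).1) ∧
        ∀ i : {i // i ∉ J}, (u i : Fin n → F) - ∑ j : J, a i j • (u j).1 - (w i).1 ∈ C}) ?_
      (M := b * (Gr F n k).ncard) ?_).trans (by rw [Nat.card_fin])
  · rintro C ⟨hC, hns⟩
    obtain ⟨r, hr, hrn, J, h⟩ := exists_of_not_spreadsLight hns
    obtain ⟨r, rfl⟩ := Nat.exists_eq_succ_of_ne_zero hr.ne'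
    exact ⟨⟨r, hrn⟩, hC, J, h⟩
  rintro ⟨r', hr'⟩
  simp only
  set r := r' + 1
  refine (ncard_le_card_mul_of_cover (ι := Finset (Fin r))
    (fun J => {C | C ∈ Gr F n k ∧ (J.card : ℝ) < c * r ∧
      ∃ u : Fin r → {v : Fin n → F // weight v ≤ m},
      ∃ a : {i // i ∉ J} → J → F, ∃ w : {i // i ∉ J} → {v : Fin n → F // weight v ≤ m},
        LinearIndependent F
          (fun i : {i // i ∉ J} => (u i : Fin n → F) - ∑ j : J, a i j • (u j).1 - (w i).1) ∧
        ∀ i : {i // i ∉ J}, (u i : Fin n → F) - ∑ j : J, a i j • (u j).1 - (w i).1 ∈ C}) ?_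
      -- The 2^r choices of J are paid for in advance.
      (M := b / 2 ^ r * (Gr F n k).ncard) ?_).trans ?_
  · rintro C ⟨hC, J, h⟩
    exact ⟨J, hC, h⟩
  · intro J
    by_cases hJ : (J.card : ℝ) < c * r
    swap
    · simp only [hJ, false_and, and_false, Set.ofPred_false, Set.ncard_empty, Nat.cast_zero]
      positivity
    simp only [hJ, true_and]
    refine (ncard_not_spreadsLight_aux hk J).trans ?_
    refine mul_le_mul_of_nonneg_right ?_ (by positivity)
    rw [← hΛ, ← hq]
    have hrn : (r : ℝ) ≤ n := by exact_mod_cast hr'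
    have hJT : J.card ≤ T := by
      have : (J.card : ℝ) ≤ T := by nlinarith
      exact_mod_cast this
    have hr0 : 0 < r := Nat.succ_pos _
    -- From c ≤ 1/2: at least r/2 vectors lie outside J, so Λ^r and 2^r are bounded by powers with
    -- exponent 2s.
    have h2 : 2 * J.card ≤ r := by
      have : 2 * (J.card : ℝ) ≤ r := by nlinarith [(by positivity : (0 : ℝ) ≤ r)]
      exact_mod_cast this
    set s := r - J.card
    have hrs : r ≤ 2 * s := by omega
    have hs : s ≠ 0 := by omega
    rw [le_div_iff₀ (by positivity)]
    calc Λ ^ r * (q ^ J.card * Λ * (q ^ (n - k))⁻¹) ^ s * 2 ^ r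
        ≤ Λ ^ (2 * s) * (q ^ T * Λ * (q ^ (n - k))⁻¹) ^ s * 2 ^ (2 * s) := by
          gcongr
          norm_num
      _ = b ^ s := by rw [pow_mul, pow_mul, ← mul_pow, ← mul_pow, hbdef]; ring
      _ ≤ b := pow_le_of_le_one hb0 hb hs
  · rw [Nat.card_eq_fintype_card, Fintype.card_finset, Fintype.card_fin]
    push_cast
    rw [← mul_assoc, mul_div_cancel₀ _ (by positivity)]

/-! ### Rank factorization and the number of light matrices -/

theorem Submodule.exists_fun_fin_span_eq {K V : Type*} [Field K] [AddCommGroup V] [Module K V]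
    [FiniteDimensional K V] (s : Set V) {r : ℕ} (hr : Module.finrank K (Submodule.span K s) = r) :
    ∃ f : Fin r → V, (∀ i, f i ∈ s) ∧ Submodule.span K (Set.range f) = Submodule.span K s ∧
      LinearIndependent K f := by
  subst hr
  exact Submodule.exists_fun_fin_finrank_span_eq K s

open Matrix in
/-- Rank factorization through a maximal invertible submatrix. -/
theorem Matrix.exists_submatrix_factorization {K m n : Type*} [Field K] [Fintype m] [Fintype n]
    (X : Matrix m n K) {r : ℕ} (hr : X.rank = r) :
    ∃ (I : Fin r → m) (J : Fin r → n),
      LinearIndependent K (fun j => X.col (J j)) ∧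
      X = X.submatrix id J * (X.submatrix I J)⁻¹ * X.submatrix I id := by
  classical
  obtain ⟨f, hf, hspan, hli⟩ := Submodule.exists_fun_fin_span_eq (Set.range X.row)
    ((Matrix.rank_eq_finrank_span_row X).symm.trans hr)
  choose I hI using hf
  set Y := X.submatrix I id with hY
  have hYrow : Y.row = f := funext fun i => hI i
  have hYr : Y.rank = r := by
    rw [Matrix.rank_eq_finrank_span_row, hYrow, finrank_span_eq_card hli, Fintype.card_fin]
  obtain ⟨g, hg, -, hgli⟩ := Submodule.exists_fun_fin_span_eq (Set.range Y.col)
    ((Matrix.rank_eq_finrank_span_cols Y).symm.trans hYr)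
  choose J hJ using hg
  have hZ : IsUnit (X.submatrix I J) := by
    rw [← Matrix.linearIndependent_cols_iff_isUnit]
    have : (X.submatrix I J).col = g := funext fun j => hJ j
    rwa [this]
  refine ⟨I, J, ?_, ?_⟩
  · refine LinearIndependent.of_comp (LinearMap.funLeft K K I) ?_
    have : (LinearMap.funLeft K K I) ∘ (fun j => X.col (J j)) = g := funext fun j => hJ j
    rwa [this]
  · have hmem : ∀ i, ∃ a : Fin r → K, a ᵥ* Y = X i := fun i => by
      have : X.row i ∈ Submodule.span K (Set.range f) := by
        rw [hspan]; exact Submodule.subset_span ⟨i, rfl⟩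
      obtain ⟨a, ha⟩ := (Submodule.mem_span_range_iff_exists_fun K).1 this
      refine ⟨a, ?_⟩
      rw [Matrix.vecMul_eq_sum]
      refine (Finset.sum_congr rfl fun i _ => ?_).trans ha
      rw [← hI]
      rfl
    choose A hA using hmem
    have hAX : (Matrix.of A) * Y = X := by
      ext i j
      exact congrFun (hA i) j
    have h1 : X.submatrix id J = Matrix.of A * X.submatrix I J := by
      conv_lhs => rw [← hAX]
      rfl
    rw [h1, Matrix.mul_assoc _ (X.submatrix I J), Matrix.mul_nonsing_inv _
      ((Matrix.isUnit_iff_isUnit_det _).1 hZ), Matrix.mul_one, hAX]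

/-- Square matrices all of whose rows and columns have weight at most `m`. -/
def IsLightMatrix {F : Type*} [Field F] {n : ℕ} (m : ℕ) (X : Matrix (Fin n) (Fin n) F) : Prop :=
  (∀ i, weight (X.row i) ≤ m) ∧ ∀ j, weight (X.col j) ≤ m

/-- By rank factorization X is recovered from r of its rows and r of its columns, all light,
together with their positions; the invertible core is read off from the chosen rows. -/
theorem card_isLightMatrix_le {F : Type*} [Field F] [Finite F] {n m r : ℕ} :
    Nat.card {X : Matrix (Fin n) (Fin n) F // IsLightMatrix m X ∧ X.rank = r} ≤
      (n * numLight F n m) ^ (2 * r) := by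
  classical
  choose I J _ h using fun X : {X : Matrix (Fin n) (Fin n) F // IsLightMatrix m X ∧ X.rank = r} =>
    X.1.exists_submatrix_factorization X.2.2
  let L := {v : Fin n → F // weight v ≤ m}
  let φ : {X : Matrix (Fin n) (Fin n) F // IsLightMatrix m X ∧ X.rank = r} →
      ((Fin r → Fin n) × (Fin r → Fin n)) × ((Fin r → L) × (Fin r → L)) := fun X =>
    ((I X, J X), (fun i => ⟨X.1.row (I X i), X.2.1.1 _⟩, fun j => ⟨X.1.col (J X j), X.2.1.2 _⟩))
  have hφ : Function.Injective φ := by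
    intro X Y hXY
    simp only [φ, Prod.mk.injEq] at hXY
    obtain ⟨⟨hI, hJ⟩, hR, hC⟩ := hXY
    have hrow : X.1.submatrix (I X) id = Y.1.submatrix (I Y) id := by
      ext i j
      exact congrFun (congrArg Subtype.val (congrFun hR i)) j
    have hcol : X.1.submatrix id (J X) = Y.1.submatrix id (J Y) := by
      ext i j
      exact congrFun (congrArg Subtype.val (congrFun hC j)) i
    have hIJ : X.1.submatrix (I X) (J X) = Y.1.submatrix (I Y) (J Y) := by
      have := congrArg (fun M => M.submatrix id (J X)) hrow
      simpa [hJ] using this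
    apply Subtype.ext
    rw [h X, h Y, hrow, hcol, hIJ]
  refine (Nat.card_le_card_of_injective φ hφ).trans (le_of_eq ?_)
  rw [Nat.card_prod, Nat.card_prod, Nat.card_prod, Nat.card_fun, Nat.card_fun, Nat.card_fin,
    Nat.card_fin]
  change n ^ r * n ^ r * (numLight F n m ^ r * numLight F n m ^ r) = _
  ring

/-- Indicator vectors inject small sets into light vectors, so a union over sets B costs only one
more factor `numLight`. -/
theorem card_finset_le_numLight {F : Type*} [Field F] [Finite F] {n m : ℕ} :
    Nat.card {B : Finset (Fin n) // B.card ≤ m} ≤ numLight F n m := by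
  classical
  refine Nat.card_le_card_of_injective
    (fun B => ⟨fun i => if i ∈ B.1 then (1 : F) else 0, ?_⟩) ?_
  · refine (weight_le_card (B := B.1) fun i hi => ?_).trans B.2
    simp [hi]
  · intro B D h
    apply Subtype.ext
    ext i
    have := congrFun (congrArg Subtype.val h) i
    by_cases hB : i ∈ B.1 <;> by_cases hD : i ∈ D.1 <;> simp_all

/-! ### Light matrices in the sum of the two column and row codes -/

/-- `C₁ ⊗ F ^ n + F ^ n ⊗ C₂`, up to the rows in `B₁` and the columns in `B₂`, contains a nonzero
light matrix `X` (detected by the dual codewords of `C₁` vanishing on `B₁`). -/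
def HasLightSum {F : Type*} [Field F] {n : ℕ} (m : ℕ) (C₁ C₂ : Submodule F (Fin n → F)) : Prop :=
  ∃ B₁ B₂ : Finset (Fin n), B₁.card ≤ m ∧ B₂.card ≤ m ∧ ∃ X : Matrix (Fin n) (Fin n) F,
    X ≠ 0 ∧ IsLightMatrix m X ∧ (∀ j, X.col j ∈ supportedOn F B₁ᶜ) ∧
      (∀ i, X.row i ∈ supportedOn F B₂ᶜ) ∧
      ∀ f ∈ dualCode C₁ ⊓ supportedOn F B₁ᶜ, Matrix.vecMul f X ∈ C₂ ⊔ supportedOn F B₂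

/-- Independent dual certificates for a light matrix, in case `C₁` spreads light vectors. -/
theorem SpreadsLight.exists_dual {F : Type*} [Field F] {n m r : ℕ} {c : ℝ}
    {C : Submodule F (Fin n → F)} (h : SpreadsLight m c C) {B : Finset (Fin n)} (hB : B.card ≤ m)
    {X : Matrix (Fin n) (Fin n) F} (hX : IsLightMatrix m X) (hr : X.rank = r)
    (hXB : ∀ j, X.col j ∈ supportedOn F B ᶜ) :
    ∃ s : ℕ, c * r ≤ s ∧ ∃ f : Fin s → Fin n → F,
      (∀ j, f j ∈ dualCode C ⊓ supportedOn F Bᶜ) ∧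
      LinearIndependent F fun j => Matrix.vecMul (f j) X := by
  classical
  obtain ⟨-, J', hli, -⟩ := X.exists_submatrix_factorization hr
  obtain ⟨J, hJ, f, hf⟩ := h B hB r _ hli (fun i => hX.2 _) (fun i => hXB _)
  let e := J.equivFin
  refine ⟨J.card, hJ, fun j => f (e.symm j), fun j => (hf _ (e.symm j).2).1, ?_⟩
  refine LinearIndependent.of_comp (LinearMap.funLeft F F fun j => J' (e.symm j)) ?_
  -- Restricted to the columns of X selected by J, the vectors `f j` X become the standard basis.
  have : (LinearMap.funLeft F F fun j => J' (e.symm j)) ∘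
      (fun j => Matrix.vecMul (f (e.symm j)) X) = fun j => Pi.single j 1 := by
    funext j i
    have h1 := (hf _ (e.symm j).2).2 _ (e.symm i).2
    change f (e.symm j) ⬝ᵥ X.col (J' (e.symm i)) = _
    rw [h1, Pi.single_apply]
    simp [Subtype.ext_iff.symm]
  rw [this]
  convert (Pi.basisFun F (Fin J.card)).linearIndependent with j
  simp

theorem LinearIndependent.add_supportedOn {F ι : Type*} [Field F] {n : ℕ} {B : Finset (Fin n)}
    {y w : ι → Fin n → F} (hy : LinearIndependent F y) (hyB : ∀ i, y i ∈ supportedOn F Bᶜ)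
    (hw : ∀ i, w i ∈ supportedOn F B) : LinearIndependent F (fun i => y i + w i) := by
  refine LinearIndependent.of_comp (puncture F B) ?_
  convert hy using 1
  funext i
  simp [puncture_eq_zero (hw i), puncture_eq_self (hyB i)]

/-- The union bound over the ways to complete the given vectors `y` to codewords. -/
theorem ncard_gr_light_completion_le {F : Type*} [Field F] [Finite F] {n k m s : ℕ} (hk : k ≤ n)
    (y : Fin s → Fin n → F) :
    ({C | C ∈ Gr F n k ∧ ∃ w : Fin s → {v : Fin n → F // weight v ≤ m},
      LinearIndependent F (fun i => y i + (w i).1) ∧ ∀ i, y i + (w i).1 ∈ C}.ncard : ℝ) ≤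
      (numLight F n m * ((Nat.card F : ℝ) ^ (n - k))⁻¹) ^ s * (Gr F n k).ncard := by
  refine (ncard_le_card_mul_of_cover (ι := Fin s → {v : Fin n → F // weight v ≤ m})
    (fun w => {C | C ∈ Gr F n k ∧ LinearIndependent F (fun i => y i + (w i).1) ∧
      ∀ i, y i + (w i).1 ∈ C})
    ?_ (M := ((((Nat.card F : ℝ) ^ (n - k))⁻¹) ^ s * (Gr F n k).ncard)) ?_).trans ?_
  · rintro C ⟨hC, w, h⟩
    exact ⟨w, hC, h⟩
  · intro w
    by_cases hli : LinearIndependent F (fun i => y i + (w i).1)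
    · have := ncard_gr_containing_le hk hli
      rw [Fintype.card_fin] at this
      simpa only [hli, true_and] using this
    · simp only [hli, false_and, and_false, Set.ofPred_false, Set.ncard_empty, Nat.cast_zero]
      positivity
  · rw [Nat.card_fun, Nat.card_fin]
    change ((numLight F n m ^ s : ℕ) : ℝ) * _ ≤ _
    push_cast
    rw [mul_pow]
    exact le_of_eq (by ring)

/-- If `C₁` spreads light vectors then `C₁ ⊗ F ^ n + F ^ n ⊗ C₂` contains no light matrix for most
codes `C₂`. -/
theorem ncard_hasLightSum_le {F : Type*} [Field F] [Finite F] {n k m : ℕ} {c : ℝ}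
    (hk : k ≤ n) {C₁ : Submodule F (Fin n → F)} (hC₁ : SpreadsLight m c C₁)
    (hd : (numLight F n m : ℝ) * ((Nat.card F : ℝ) ^ (n - k))⁻¹ ≤ 1)
    (hb : (n : ℝ) ^ 2 * (numLight F n m : ℝ) ^ 3 *
      (numLight F n m * ((Nat.card F : ℝ) ^ (n - k))⁻¹) ^ c ≤ 1) :
    ({C | C ∈ Gr F n k ∧ HasLightSum m C₁ C}.ncard : ℝ) ≤
      n * ((n : ℝ) ^ 2 * (numLight F n m : ℝ) ^ 3 *
      (numLight F n m * ((Nat.card F : ℝ) ^ (n - k))⁻¹) ^ c * (Gr F n k).ncard) := by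
  classical
  set Λ : ℝ := (numLight F n m : ℝ) with hΛ
  set d : ℝ := Λ * ((Nat.card F : ℝ) ^ (n - k))⁻¹ with hddef
  set b := (n : ℝ) ^ 2 * Λ ^ 3 * d ^ c with hbdef
  have hΛ1 : 1 ≤ Λ := by rw [hΛ]; exact_mod_cast one_le_numLight F n m
  have hq0 : (0 : ℝ) < Nat.card F := by exact_mod_cast (Nat.card_pos : 0 < Nat.card F)
  have hd0 : 0 < d := by positivity
  have hb0 : 0 ≤ b := by positivity
  -- The union runs over X and B₁ only; B₂ is absorbed into the light vectors completing each fX to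
  -- a codeword of C₂.
  let S : (r : ℕ) → Type _ := fun r =>
    {X : Matrix (Fin n) (Fin n) F // IsLightMatrix m X ∧ X.rank = r} ×
      {B : Finset (Fin n) // B.card ≤ m}
  let E : (r : ℕ) → S r → Set (Submodule F (Fin n → F)) := fun r p =>
    {C | C ∈ Gr F n k ∧ (∀ j, p.1.1.col j ∈ supportedOn F p.2.1ᶜ) ∧ ∃ B₂ : Finset (Fin n),
      B₂.card ≤ m ∧ (∀ i, p.1.1.row i ∈ supportedOn F B₂ᶜ) ∧
      ∀ f ∈ dualCode C₁ ⊓ supportedOn F p.2.1ᶜ, Matrix.vecMul f p.1.1 ∈ C ⊔ supportedOn F B₂}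
  refine (ncard_le_card_mul_of_cover (ι := Fin n) (fun r => {C | ∃ p, C ∈ E (r + 1) p}) ?_
      (M := b * (Gr F n k).ncard) ?_).trans (by rw [Nat.card_fin])
  · rintro C ⟨hC, B₁, B₂, hB₁, hB₂, X, hX0, hX, hX1, hX2, hf⟩
    have hr : X.rank ≠ 0 := fun h => hX0 <| by
      obtain ⟨I, J, -, hIJ⟩ := X.exists_submatrix_factorization h
      rw [hIJ]
      ext i j
      rw [Matrix.mul_apply]
      exact Finset.sum_eq_zero fun l _ => l.elim0
    obtain ⟨r, hr⟩ := Nat.exists_eq_succ_of_ne_zero hr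
    have hrn : r < n := by
      have := X.rank_le_card_width
      rw [Fintype.card_fin] at this
      omega
    exact ⟨⟨r, hrn⟩, (⟨X, hX, hr⟩, ⟨B₁, hB₁⟩), hC, hX1, B₂, hB₂, hX2, hf⟩
  rintro ⟨r', hr'⟩
  simp only
  set r := r' + 1
  have hE : ∀ p : S r, ((E r p).ncard : ℝ) ≤ (d ^ c) ^ r * (Gr F n k).ncard := by
    rintro ⟨⟨X, hX, hr⟩, ⟨B, hB⟩⟩
    by_cases hXB : ∀ j, X.col j ∈ supportedOn F Bᶜ
    swap
    · simp only [E, hXB, false_and, and_false, Set.ofPred_false, Set.ncard_empty, Nat.cast_zero]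
      positivity
    obtain ⟨s, hs, f, hf, hli⟩ := hC₁.exists_dual hB hX hr hXB
    calc ((E r (⟨X, hX, hr⟩, ⟨B, hB⟩)).ncard : ℝ) ≤ d ^ s * (Gr F n k).ncard := by
          refine le_trans ?_ (ncard_gr_light_completion_le (m := m) hk
            fun j => Matrix.vecMul (f j) X)
          refine Nat.cast_le.2 (Set.ncard_le_ncard ?_ (Set.toFinite _))
          rintro C ⟨hC, -, B₂, hB₂, hX2, hmem⟩
          have : ∀ j, ∃ w ∈ supportedOn F B₂, Matrix.vecMul (f j) X + w ∈ C := fun j => by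
            obtain ⟨x, hx, w, hw, hxw⟩ := Submodule.mem_sup.1 (hmem (f j) (hf j))
            refine ⟨-w, Submodule.neg_mem _ hw, ?_⟩
            rw [← hxw, add_neg_cancel_right]
            exact hx
          choose w hw hwC using this
          refine ⟨hC, fun j => ⟨w j, (weight_le_card (hw j)).trans hB₂⟩,
            hli.add_supportedOn (fun j => ?_) hw, hwC⟩
          rw [mem_supportedOn_compl]
          intro i hi
          change ∑ l, f j l * X l i = 0
          refine Finset.sum_eq_zero fun l _ => ?_
          have : X l i = 0 := mem_supportedOn_compl.1 (hX2 l) i hi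
          rw [this, mul_zero]
      _ ≤ (d ^ c) ^ r * (Gr F n k).ncard := by
          refine mul_le_mul_of_nonneg_right ?_ (by positivity)
          rw [← Real.rpow_natCast, ← Real.rpow_natCast (d ^ c), ← Real.rpow_mul hd0.le]
          exact Real.rpow_le_rpow_of_exponent_ge hd0 hd hs
  refine (ncard_le_card_mul_of_cover (ι := S r) (E r) (fun C hC => hC) hE).trans ?_
  rw [← mul_assoc]
  refine mul_le_mul_of_nonneg_right ?_ (by positivity)
  have hcard : (Nat.card (S r) : ℝ) ≤ ((n : ℝ) * Λ) ^ (2 * r) * Λ := by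
    rw [Nat.card_prod]
    have := Nat.mul_le_mul (card_isLightMatrix_le (F := F) (n := n) (m := m) (r := r))
      (card_finset_le_numLight (F := F) (n := n) (m := m))
    rw [hΛ]
    exact_mod_cast this
  have hr0 : r ≠ 0 := Nat.succ_ne_zero _
  calc (Nat.card (S r) : ℝ) * (d ^ c) ^ r ≤ (((n : ℝ) * Λ) ^ (2 * r) * Λ ^ r) * (d ^ c) ^ r := by
        refine mul_le_mul_of_nonneg_right (hcard.trans ?_) (by positivity)
        -- The single factor Λ for the choice of B₁ is raised to Λ^r, so that the total is an r-th
        -- power.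
        exact mul_le_mul_of_nonneg_left (le_self_pow₀ hΛ1 hr0) (by positivity)
    _ = b ^ r := by rw [pow_mul, ← mul_pow, ← mul_pow, hbdef]; ring
    _ ≤ b := pow_le_of_le_one hb0 hb hr0

/-! ### From spreading to robust testability -/

/-- Spreading contains a minimum distance bound: for a single light v ≠ 0 and B empty it yields a
dual word pairing to 1 with v, impossible for v in C. -/
theorem SpreadsLight.eq_zero_of_mem {F : Type*} [Field F] {n m : ℕ} {c : ℝ} (hc : 0 < c)
    {C : Submodule F (Fin n → F)} (h : SpreadsLight m c C) {v : Fin n → F} (hv : v ∈ C)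
    (hvm : weight v ≤ m) : v = 0 := by
  by_contra hv0
  obtain ⟨J, hJ, f, hf⟩ := h ∅ (by simp) 1 (fun _ => v)
    (linearIndependent_unique_iff.2 hv0) (fun _ => hvm)
    (fun _ => mem_supportedOn_compl.2 (by simp))
  have hJ0 : (0 : ℝ) < J.card := lt_of_lt_of_le (by simpa using hc) hJ
  obtain ⟨j, hj⟩ := Finset.card_pos.1 (by exact_mod_cast hJ0)
  have h1 := (hf j hj).2 j hj
  rw [if_pos rfl, dotProduct_comm, (mem_dualCode.1 (hf j hj).1.1) v hv] at h1
  exact zero_ne_one h1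

/-- If no nonzero codeword is supported on `B`, codewords can be recovered linearly from their
punctured versions. -/
theorem exists_recovery {F : Type*} [Field F] {n : ℕ} {C : Submodule F (Fin n → F)}
    {B : Finset (Fin n)} (h : ∀ v ∈ C, v ∈ supportedOn F B → v = 0) :
    ∃ P : (Fin n → F) →ₗ[F] (Fin n → F), (∀ v, P v ∈ C) ∧ (∀ v ∈ C, P v = v) ∧
      ∀ v ∈ supportedOn F B, P v = 0 := by
  obtain ⟨g, hg⟩ := LinearMap.exists_leftInverse_of_injective (puncture F B ∘ₗ C.subtype)
    (by
      rw [LinearMap.ker_eq_bot']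
      rintro ⟨v, hv⟩ hv0
      refine Subtype.ext (h v hv fun i hi => ?_)
      have := congrFun hv0 i
      simpa [puncture_apply, hi] using this)
  refine ⟨C.subtype ∘ₗ g ∘ₗ puncture F B, fun v => (g _).2, fun v hv => ?_, fun v hv => ?_⟩
  · have := LinearMap.congr_fun hg ⟨v, hv⟩
    simpa using congrArg Subtype.val this
  · simp [puncture_eq_zero hv]

theorem LinearMap.apply_eq_sum_single {F : Type*} [Field F] {n : ℕ}
    (P : (Fin n → F) →ₗ[F] (Fin n → F)) (v : Fin n → F) (i : Fin n) :
    P v i = ∑ l, v l * P (Pi.single l 1) i := by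
  conv_lhs => rw [pi_eq_sum_univ' v]
  simp [map_sum]

/-- Two matrices with columns in `C₁`, resp. rows in `C₂`, which agree outside the rows in `B₁`
and the columns in `B₂`, agree outside the columns in `B₂` with a product codeword. -/
theorem exists_productCode_eq {F : Type*} [Field F] {n : ℕ} {C₁ C₂ : Submodule F (Fin n → F)}
    {B₁ B₂ : Finset (Fin n)} (h : ∀ v ∈ C₁, v ∈ supportedOn F B₁ → v = 0)
    {a b : Fin n × Fin n → F} (ha : ∀ j, (fun i => a (i, j)) ∈ C₁)
    (hb : ∀ i, (fun j => b (i, j)) ∈ C₂) (hab : ∀ i ∉ B₁, ∀ j ∉ B₂, a (i, j) = b (i, j)) :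
    ∃ x ∈ productCode C₁ C₂, ∀ i, ∀ j ∉ B₂, x (i, j) = a (i, j) := by
  obtain ⟨P, hP, hPC, hPB⟩ := exists_recovery h
  -- The recovery map P acts on the columns of b. Columns land in C₁; each row of the result is a
  -- linear combination of rows of b, hence in C₂.
  refine ⟨fun p => P (fun i => b (i, p.2)) p.1, ⟨fun j => hP fun i => b (i, j), fun i => ?_⟩, fun i j hj => ?_⟩
  · have : (fun j => P (fun i => b (i, j)) i) =
        ∑ l, P (Pi.single l 1) i • (fun j => b (l, j)) := by
      funext j
      rw [LinearMap.apply_eq_sum_single]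
      simp [Finset.sum_apply, mul_comm]
    change (fun j => P (fun i => b (i, j)) i) ∈ C₂
    rw [this]
    exact C₂.sum_mem fun l _ => C₂.smul_mem _ (hb l)
  · have h1 : P ((fun i => b (i, j)) - fun i => a (i, j)) = 0 :=
      hPB _ fun l hl => by simp [hab l hl j hj]
    rw [map_sub, sub_eq_zero, hPC _ (ha j)] at h1
    exact congrFun h1 i

theorem weight_neg {F ι : Type*} [Field F] [Fintype ι] (v : ι → F) :
    weight (-v) = weight v := by
  classical
  simp [weight, hammingNorm]

theorem relDist_eq_weight {F ι : Type*} [Field F] [Fintype ι] (x y : ι → F) :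
    relDist x y = (weight (x - y) : ℝ) / Fintype.card ι := by
  classical
  rw [← weight_neg, neg_sub, relDist, hammingDist_eq_hammingNorm, weight, neg_add_eq_sub]

theorem exists_relDistTo_eq {F ι : Type*} [Field F] [Finite F] [Fintype ι] (x : ι → F)
    (C : Submodule F (ι → F)) : ∃ y ∈ C, relDistTo x C = (weight (x - y) : ℝ) / Fintype.card ι := by
  classical
  obtain ⟨y, hy⟩ := exists_eq_ciInf_of_finite (f := fun c : C => relDist x (c : ι → F))
  refine ⟨y, y.2, ?_⟩
  rw [relDistTo, ← hy, relDist_eq_weight]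

theorem relDistTo_le {F ι : Type*} [Field F] [Finite F] [Fintype ι] (x : ι → F)
    {C : Submodule F (ι → F)} {y : ι → F} (hy : y ∈ C) :
    relDistTo x C ≤ (weight (x - y) : ℝ) / Fintype.card ι := by
  classical
  refine (ciInf_le (Set.finite_range _).bddBelow (⟨y, hy⟩ : C)).trans (le_of_eq ?_)
  rw [relDist_eq_weight]

theorem weight_add_le {F ι : Type*} [Field F] [Fintype ι] (v w : ι → F) :
    weight (v + w) ≤ weight v + weight w := by
  classical
  unfold weight hammingNorm
  refine (Finset.card_le_card ?_).trans (Finset.card_union_le _ _)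
  intro i
  simp only [Finset.mem_filter_univ, Finset.mem_union, Pi.add_apply]
  contrapose!
  rintro ⟨h1, h2⟩
  rw [h1, h2, add_zero]

theorem weight_le_fintypeCard {F ι : Type*} [Field F] [Fintype ι] (v : ι → F) :
    weight v ≤ Fintype.card ι := by
  classical
  exact hammingNorm_le_card_fintype

theorem weight_mono {F ι : Type*} [Field F] [Fintype ι] {v w : ι → F}
    (h : ∀ i, v i ≠ 0 → w i ≠ 0) : weight v ≤ weight w := by
  classical
  exact Finset.card_le_card fun i => by simpa using h i

theorem weight_eq_sum_rows {F : Type*} [Field F] {n : ℕ} (x : Fin n × Fin n → F) :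
    weight x = ∑ i, weight (fun j => x (i, j)) := by
  classical
  simp only [weight, hammingNorm, Finset.card_filter]
  rw [Fintype.sum_prod_type]

theorem weight_eq_sum_cols {F : Type*} [Field F] {n : ℕ} (x : Fin n × Fin n → F) :
    weight x = ∑ j, weight (fun i => x (i, j)) := by
  classical
  simp only [weight, hammingNorm, Finset.card_filter]
  rw [Fintype.sum_prod_type_right]

/-- Markov's inequality: each heavy index contributes more than αn to a sum bounded by W. -/
theorem card_heavy_le {n : ℕ} {α : ℝ} {g : Fin n → ℕ} {W : ℝ}
    (hg : ((∑ i, g i : ℕ) : ℝ) ≤ W) :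
    α * n * ((Finset.univ.filter fun i => ⌊α * n⌋₊ < g i).card : ℝ) ≤ W := by
  refine le_trans ?_ hg
  rw [Nat.cast_sum]
  calc α * n * ((Finset.univ.filter fun i => ⌊α * n⌋₊ < g i).card : ℝ)
      = ∑ i ∈ Finset.univ.filter fun i => ⌊α * n⌋₊ < g i, α * n := by
        rw [Finset.sum_const, nsmul_eq_mul, mul_comm]
    _ ≤ ∑ i ∈ Finset.univ.filter fun i => ⌊α * n⌋₊ < g i, (g i : ℝ) :=
        Finset.sum_le_sum fun i hi => (Nat.lt_of_floor_lt (Finset.mem_filter.1 hi).2).le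
    _ ≤ ∑ i, (g i : ℝ) :=
        Finset.sum_le_sum_of_subset_of_nonneg (Finset.filter_subset _ _) fun _ _ _ => by positivity

/-- A matrix with few nonzero entries in `C₁ ⊗ F ^ n + F ^ n ⊗ C₂` vanishes outside its heavy rows
and columns, unless `HasLightSum` holds. -/
theorem eq_off_heavy {F : Type*} [Field F] {n m : ℕ} {C₁ C₂ : Submodule F (Fin n → F)}
    (h : ¬ HasLightSum m C₁ C₂) {a b : Fin n × Fin n → F}
    (ha : ∀ j, (fun i => a (i, j)) ∈ C₁) (hb : ∀ i, (fun j => b (i, j)) ∈ C₂)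
    {B₁ B₂ : Finset (Fin n)} (hB₁ : B₁.card ≤ m) (hB₂ : B₂.card ≤ m)
    (h₁ : ∀ i ∉ B₁, weight (fun j => (a - b) (i, j)) ≤ m)
    (h₂ : ∀ j ∉ B₂, weight (fun i => (a - b) (i, j)) ≤ m) :
    ∀ i ∉ B₁, ∀ j ∉ B₂, a (i, j) = b (i, j) := by
  let X : Matrix (Fin n) (Fin n) F :=
    Matrix.of fun i j => if i ∈ B₁ ∨ j ∈ B₂ then 0 else (a - b) (i, j)
  have hX : ∀ i j, X i j = if i ∈ B₁ ∨ j ∈ B₂ then 0 else (a - b) (i, j) := fun _ _ => rfl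
  suffices h0 : X = 0 by
    intro i hi j hj
    have := hX i j
    rw [h0] at this
    simpa [hi, hj, sub_eq_zero] using this.symm
  by_contra h0
  refine h ⟨B₁, B₂, hB₁, hB₂, X, h0, ⟨fun i => ?_, fun j => ?_⟩, fun j => ?_, fun i => ?_, ?_⟩
  · by_cases hi : i ∈ B₁
    · have : X.row i = 0 := funext fun j => by simp [Matrix.row, hX, hi]
      simp [this, weight]
    · refine (weight_mono fun j hj h0 => hj ?_).trans (h₁ i hi)
      simp only [Matrix.row, hX, h0, ite_self]
  · by_cases hj : j ∈ B₂
    · have : X.col j = 0 := funext fun i => by simp [Matrix.col, hX, hj]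
      simp [this, weight]
    · refine (weight_mono fun i hi h0 => hi ?_).trans (h₂ j hj)
      simp only [Matrix.col, Matrix.transpose_apply, hX, h0, ite_self]
  · exact mem_supportedOn_compl.2 fun i hi => by simp [Matrix.col, hX, hi]
  · exact mem_supportedOn_compl.2 fun j hj => by simp [Matrix.row, hX, hj]
  · rintro f ⟨hf, hfB⟩
    rw [SetLike.mem_coe, mem_supportedOn_compl] at hfB
    -- Since f annihilates the columns of a and vanishes on B₁, off B₂ the vector fX equals minus
    -- the combination of rows of b with coefficients f, a word of C₂.
    have hmem : -(∑ i, f i • (fun j => b (i, j))) ∈ C₂ :=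
      C₂.neg_mem (C₂.sum_mem fun i _ => C₂.smul_mem _ (hb i))
    rw [← add_sub_cancel (-(∑ i, f i • (fun j => b (i, j)))) (Matrix.vecMul f X)]
    refine Submodule.add_mem_sup hmem ?_
    rw [mem_supportedOn]
    intro j hj
    have h1 : (fun i => a (i, j)) ⬝ᵥ f = 0 := hf _ (ha j)
    have h2 : Matrix.vecMul f X j = ∑ i, f i * (a (i, j) - b (i, j)) := by
      change ∑ i, f i * X i j = _
      refine Finset.sum_congr rfl fun i _ => ?_
      by_cases hi : i ∈ B₁
      · simp [hfB i hi]
      · simp [hX, hi, hj]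
    have h3 : ∑ i, f i * a (i, j) = 0 := by
      rw [← h1]
      exact Finset.sum_congr rfl fun i _ => mul_comm _ _
    simp [h2, mul_sub, h3, Finset.sum_apply]

theorem isRobustlyTestable_of_spreadsLight {F : Type*} [Field F] [Finite F] {n : ℕ} (hn : 0 < n)
    {α c ρ : ℝ} (hα : 0 < α) (hc : 0 < c) (hρ0 : 0 ≤ ρ) (hρ : ρ ≤ α ^ 2 / 2)
    (hρ' : ρ * (1 + 1 / α) ≤ 1 / 2) {C₁ C₂ : Submodule F (Fin n → F)}
    (h₁ : SpreadsLight ⌊α * n⌋₊ c C₁) (h₂ : ¬ HasLightSum ⌊α * n⌋₊ C₁ C₂) :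
    IsRobustlyTestable ρ C₁ C₂ := by
  intro x
  obtain ⟨a, ha, hda⟩ := exists_relDistTo_eq x (productCode C₁ (⊤ : Submodule F (Fin n → F)))
  obtain ⟨b, hb, hdb⟩ := exists_relDistTo_eq x (productCode (⊤ : Submodule F (Fin n → F)) C₂)
  rw [hda, hdb, ← add_div]
  have hN : (Fintype.card (Fin n × Fin n) : ℝ) = (n : ℝ) ^ 2 := by
    rw [Fintype.card_prod, Fintype.card_fin]; push_cast; ring
  have hn0 : (0 : ℝ) < n := by exact_mod_cast hn
  rw [hN]
  set W : ℝ := (weight (x - a) : ℝ) + weight (x - b) with hW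
  suffices h : ∃ y ∈ productCode C₁ C₂, ρ * weight (x - y) ≤ 1 / 2 * W by
    obtain ⟨y, hy, hle⟩ := h
    calc ρ * relDistTo x (productCode C₁ C₂) ≤ ρ * ((weight (x - y) : ℝ) / (n : ℝ) ^ 2) :=
          mul_le_mul_of_nonneg_left (hN ▸ relDistTo_le x hy) hρ0
      _ = ρ * (weight (x - y) : ℝ) / (n : ℝ) ^ 2 := by ring
      _ ≤ (1 / 2 * W) / (n : ℝ) ^ 2 := by gcongr
      _ = 1 / 2 * (W / (n : ℝ) ^ 2) := by ring
  -- For large W the zero codeword works because ρ ≤ α²/2. For small W, Markov leaves at most αn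
  -- heavy rows and αn heavy columns.
  rcases lt_or_ge (α ^ 2 * (n : ℝ) ^ 2) W with hlarge | hsmall
  · refine ⟨0, Submodule.zero_mem _, ?_⟩
    have h1 : (weight (x - 0) : ℝ) ≤ (n : ℝ) ^ 2 := by
      rw [← hN]; exact_mod_cast weight_le_fintypeCard _
    calc ρ * (weight (x - 0) : ℝ) ≤ α ^ 2 / 2 * (n : ℝ) ^ 2 := by gcongr
      _ ≤ 1 / 2 * W := by linarith
  have hab : (weight (a - b) : ℝ) ≤ W := by
    have h1 : a - b = -(x - a) + (x - b) := by abel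
    have h2 := weight_add_le (-(x - a)) (x - b)
    rw [weight_neg] at h2
    rw [h1, hW]
    exact_mod_cast h2
  set B₁ := Finset.univ.filter fun i => ⌊α * n⌋₊ < weight (fun j => (a - b) (i, j)) with hB₁
  set B₂ := Finset.univ.filter fun j => ⌊α * n⌋₊ < weight (fun i => (a - b) (i, j)) with hB₂
  have hW₁ : α * n * (B₁.card : ℝ) ≤ W :=
    card_heavy_le (by rw [← weight_eq_sum_rows]; exact hab)
  have hW₂ : α * n * (B₂.card : ℝ) ≤ W :=
    card_heavy_le (by rw [← weight_eq_sum_cols]; exact hab)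
  have hcard : ∀ B : Finset (Fin n), α * n * (B.card : ℝ) ≤ W → B.card ≤ ⌊α * n⌋₊ :=
    fun B hB => Nat.le_floor <| by
      have : α * n * (B.card : ℝ) ≤ α * n * (α * n) := by linarith
      exact le_of_mul_le_mul_left this (by positivity)
  have hoff := eq_off_heavy h₂ ha.1 hb.2 (hcard _ hW₁) (hcard _ hW₂)
    (fun i hi => by simpa [hB₁] using hi) (fun j hj => by simpa [hB₂] using hj)
  obtain ⟨y, hy, hya⟩ := exists_productCode_eq (fun v hv hvB => h₁.eq_zero_of_mem hc hv
    ((weight_le_card hvB).trans (hcard _ hW₁))) ha.1 hb.2 hoff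
  refine ⟨y, hy, ?_⟩
  have h3 : (weight (a - y) : ℝ) ≤ W / α := by
    have h4 : weight (a - y) ≤ n * B₂.card := by
      rw [weight_eq_sum_cols, ← Finset.sum_subset (Finset.subset_univ B₂)]
      · rw [mul_comm, ← smul_eq_mul, ← Finset.sum_const]
        refine Finset.sum_le_sum fun j _ => ?_
        simpa using weight_le_fintypeCard (fun i => (a - y) (i, j))
      · intro j _ hj
        have : (fun i => (a - y) (i, j)) = 0 := funext fun i => by simp [hya i j hj]
        rw [this]
        simp [weight]
    rw [le_div_iff₀ hα]
    calc (weight (a - y) : ℝ) * α ≤ ((n * B₂.card : ℕ) : ℝ) * α := by gcongr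
      _ = α * n * B₂.card := by push_cast; ring
      _ ≤ W := hW₂
  have h5 : (weight (x - y) : ℝ) ≤ weight (x - a) + weight (a - y) := by
    have := weight_add_le (x - a) (a - y)
    rw [sub_add_sub_cancel] at this
    exact_mod_cast this
  have h6 : (weight (x - a) : ℝ) ≤ W := by
    rw [hW]; exact le_add_of_nonneg_right (by positivity)
  have hW0 : 0 ≤ W := by positivity
  calc ρ * (weight (x - y) : ℝ) ≤ ρ * (W + W / α) := by gcongr; linarith
    _ = ρ * (1 + 1 / α) * W := by ring
    _ ≤ 1 / 2 * W := by gcongr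

/-! ### Size of small Hamming balls -/

/-- Chernoff-type bound: the weight enumerator of the whole space at x factors over coordinates, and
each light vector contributes at least x^m. -/
theorem numLight_mul_pow_le (F : Type*) [Field F] [Finite F] (n m : ℕ) {x : ℝ} (hx0 : 0 < x)
    (hx1 : x ≤ 1) : (numLight F n m : ℝ) * x ^ m ≤ (1 + Nat.card F * x) ^ n := by
  classical
  cases nonempty_fintype F
  have h1 : (numLight F n m : ℝ) * x ^ m ≤ ∑ v : Fin n → F, x ^ weight v := by
    rw [numLight, Nat.card_eq_fintype_card, Fintype.card_subtype, ← nsmul_eq_mul,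
      ← Finset.sum_const]
    refine (Finset.sum_le_sum fun v hv => ?_).trans
      (Finset.sum_le_sum_of_subset_of_nonneg (Finset.subset_univ _) fun _ _ _ => by positivity)
    exact pow_le_pow_of_le_one hx0.le hx1 (Finset.mem_filter.1 hv).2
  have h2 : ∑ v : Fin n → F, x ^ weight v = (∑ a : F, if a ≠ 0 then x else 1) ^ n := by
    have := (Finset.prod_univ_sum (fun _ : Fin n => (Finset.univ : Finset F))
      (fun _ a => if a ≠ 0 then x else 1)).symm
    rw [Fintype.piFinset_univ, Fin.prod_const] at this
    rw [← this]
    refine Finset.sum_congr rfl fun v _ => ?_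
    rw [Finset.prod_ite, Finset.prod_const, Finset.prod_const_one, mul_one]
    rfl
  have h3 : (∑ a : F, if a ≠ 0 then x else 1) ≤ 1 + Nat.card F * x := by
    calc (∑ a : F, if a ≠ 0 then x else 1) ≤ ∑ a : F, ((if a = 0 then 1 else 0) + x) := by
          refine Finset.sum_le_sum fun a _ => ?_
          by_cases ha : a = 0 <;> simp [ha, hx0.le]
      _ = 1 + Nat.card F * x := by
          rw [Finset.sum_add_distrib]; simp
  rw [h2] at h1
  exact h1.trans (pow_le_pow_left₀ (Finset.sum_nonneg fun a _ => by split_ifs <;> positivity) h3 n)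

/-- The number of vectors of sufficiently small relative weight is at most `q ^ (ε n)`. -/
theorem exists_numLight_le (F : Type*) [Field F] [Finite F] {ε : ℝ} (hε : 0 < ε) :
    ∃ α : ℝ, 0 < α ∧ ∀ n : ℕ, (numLight F n ⌊α * n⌋₊ : ℝ) ≤ (Nat.card F : ℝ) ^ (ε * n) := by
  have hq : (1 : ℝ) < Nat.card F := by exact_mod_cast Finite.one_lt_card
  have hq0 : (0 : ℝ) < Nat.card F := by linarith
  set q : ℝ := (Nat.card F : ℝ) with hqdef
  have h1 : 1 < q ^ (ε / 2) := Real.one_lt_rpow hq (by positivity)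
  -- Here x makes 1 + qx ≤ q^(ε/2), with the bound 1/2 keeping log x negative; α is then defined by
  -- x^α = q^(-ε/2), so the two halves add up to ε.
  set x : ℝ := min (1 / 2) ((q ^ (ε / 2) - 1) / q) with hx
  have hx0 : 0 < x := lt_min (by norm_num) (div_pos (by linarith) hq0)
  have hx1 : x < 1 := (min_le_left _ _).trans_lt (by norm_num)
  have hx2 : 1 + q * x ≤ q ^ (ε / 2) := by
    have : x ≤ (q ^ (ε / 2) - 1) / q := min_le_right _ _
    rw [le_div_iff₀ hq0] at this
    linarith
  have hlx : 0 < -Real.log x := by linarith [Real.log_neg hx0 hx1]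
  have hlq : 0 < Real.log q := Real.log_pos hq
  refine ⟨ε / 2 * Real.log q / (-Real.log x), by positivity, fun n => ?_⟩
  set α := ε / 2 * Real.log q / (-Real.log x) with hα
  have hα0 : 0 < α := by positivity
  have h2 : q ^ (-(ε / 2) * n) ≤ x ^ ⌊α * n⌋₊ := by
    have h3 : q ^ (-(ε / 2) * n) = x ^ (α * n) := by
      rw [Real.rpow_def_of_pos hq0, Real.rpow_def_of_pos hx0]
      congr 1
      have : Real.log x ≠ 0 := by linarith
      rw [hα]
      field_simp
    rw [h3, ← Real.rpow_natCast]
    exact Real.rpow_le_rpow_of_exponent_ge hx0 hx1.le (Nat.floor_le (by positivity))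
  have h4 := numLight_mul_pow_le F n ⌊α * n⌋₊ hx0 hx1.le
  have h5 : (1 + q * x) ^ n ≤ q ^ (ε / 2 * n) := by
    rw [Real.rpow_mul hq0.le, Real.rpow_natCast]
    exact pow_le_pow_left₀ (by positivity) hx2 n
  have h6 : (numLight F n ⌊α * n⌋₊ : ℝ) * q ^ (-(ε / 2) * n) ≤ q ^ (ε / 2 * n) :=
    (mul_le_mul_of_nonneg_left h2 (by positivity)).trans (h4.trans h5)
  rw [neg_mul, Real.rpow_neg hq0.le, ← div_eq_mul_inv, div_le_iff₀ (by positivity),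
    ← Real.rpow_add hq0] at h6
  rw [show ε * (n : ℝ) = ε / 2 * n + ε / 2 * n by ring]
  exact h6

/-! ### Choice of constants and the probabilistic conclusion -/

theorem gr_nonempty (F : Type*) [Field F] {n k : ℕ} (hk : k ≤ n) : (Gr F n k).Nonempty := by
  refine ⟨Submodule.span F (Set.range (Pi.basisFun F (Fin n) ∘ Fin.castLE hk)), ?_⟩
  have := finrank_span_eq_card
    ((Pi.basisFun F (Fin n)).linearIndependent.comp _ (Fin.castLE_injective hk))
  rwa [Fintype.card_fin] at this

theorem ncard_le_mul_of_fiber_le {α β : Type*} [Finite α] [Finite β] {S : Set (α × β)} {A : Set α}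
    (hS : ∀ p ∈ S, p.1 ∈ A) {M : ℝ} (hM : ∀ a ∈ A, ({b | (a, b) ∈ S}.ncard : ℝ) ≤ M) :
    (S.ncard : ℝ) ≤ A.ncard * M := by
  refine ncard_le_card_mul_of_cover (ι := A) (fun a => Prod.mk a.1 '' {b | (a.1, b) ∈ S})
    (fun p hp => ⟨⟨p.1, hS p hp⟩, p.2, hp, rfl⟩) fun a => ?_
  exact (Nat.cast_le.2 (Set.ncard_image_le (Set.toFinite _))).trans (hM a a.2)

theorem dualCode_mem_gr {F : Type*} [Field F] {n k : ℕ} {C : Submodule F (Fin n → F)}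
    (hC : C ∈ Gr F n k) : dualCode C ∈ Gr F n (n - k) := by
  change Module.finrank F C = k at hC
  change Module.finrank F (dualCode C) = n - k
  rw [finrank_dualCode, hC]

theorem ncard_gr_sub {F : Type*} [Field F] {n k : ℕ} (hk : k ≤ n) :
    (Gr F n (n - k)).ncard = (Gr F n k).ncard := by
  refine Set.ncard_congr (fun C _ => dualCode C) (fun C hC => ?_) (fun C D _ _ h => ?_)
    fun C hC => ⟨dualCode C, dualCode_mem_gr hC, dualCode_dualCode C⟩
  · have := dualCode_mem_gr hC
    rwa [Nat.sub_sub_self hk] at this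
  · rw [← dualCode_dualCode C, h, dualCode_dualCode]

theorem ofReal_one_sub_le_uniformOn {Ω : Type*} [MeasurableSpace Ω] [MeasurableSingletonClass Ω]
    [Finite Ω] {s t : Set Ω} (hs : s.Nonempty) {δ : ℝ}
    (h : ((s \ t).ncard : ℝ) ≤ δ * s.ncard) :
    ENNReal.ofReal (1 - δ) ≤ ProbabilityTheory.uniformOn s t := by
  classical
  cases nonempty_fintype Ω
  have h1 : ProbabilityTheory.uniformOn s t = ((s ∩ t).ncard : ENNReal) / s.ncard := by
    have := ProbabilityTheory.uniformOn_apply_finset (s := s.toFinset) (t := t.toFinset)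
    simpa [Set.ncard_eq_toFinset_card', Set.toFinset_inter] using this
  have hpos : 0 < s.ncard := (Set.ncard_pos (Set.toFinite s)).2 hs
  have hpos' : (0 : ℝ) < s.ncard := by exact_mod_cast hpos
  have h2 := Set.ncard_inter_add_ncard_sdiff_eq_ncard s t (Set.toFinite s)
  have h3 : (1 - δ) ≤ ((s ∩ t).ncard : ℝ) / s.ncard := by
    rw [le_div_iff₀ hpos']
    have : ((s ∩ t).ncard : ℝ) + (s \ t).ncard = s.ncard := by exact_mod_cast h2
    linarith
  refine (ENNReal.ofReal_le_ofReal h3).trans (le_of_eq ?_)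
  rw [h1, ENNReal.ofReal_div_of_pos hpos', ENNReal.ofReal_natCast, ENNReal.ofReal_natCast]

/-- Asymptotically almost all pairs of codes of codimension at least `η n` are robustly testable,
with robustness depending only on `η`. -/
theorem exists_ncard_not_isRobustlyTestable_le (F : Type*) [Field F] [Finite F] {η : ℝ}
    (hη : 0 < η) (hη1 : η ≤ 1) :
    ∃ ρ : ℝ, 0 < ρ ∧ ∃ δ : ℕ → ℝ, Filter.Tendsto δ Filter.atTop (nhds 0) ∧
      ∀ᶠ n : ℕ in Filter.atTop, ∀ k₁ k₂ : ℕ, k₁ ≤ n → k₂ ≤ n → η * n ≤ (n - k₁ : ℕ) →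
        η * n ≤ (n - k₂ : ℕ) →
        ({C : Submodule F (Fin n → F) × Submodule F (Fin n → F) | C ∈ Gr F n k₁ ×ˢ Gr F n k₂ ∧
            ¬ IsRobustlyTestable ρ C.1 C.2}.ncard : ℝ) ≤
          δ n * ((Gr F n k₁).ncard * (Gr F n k₂).ncard) := by
  have hq : (1 : ℝ) < Nat.card F := by exact_mod_cast Finite.one_lt_card
  have hq0 : (0 : ℝ) < Nat.card F := by linarith
  set q : ℝ := (Nat.card F : ℝ) with hqdef
  -- The two exponents to control are 3ε + c - η ≤ -η/2 and 3ε + (ε - η)c ≤ -cη/2; with ε = cη/8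
  -- both follow from η ≤ 1.
  set c := η / 4 with hc
  set ε := c * η / 8 with hε
  have hc0 : 0 < c := by positivity
  have hε0 : 0 < ε := by positivity
  obtain ⟨α, hα, hL⟩ := exists_numLight_le F hε0
  set θ₁ := q ^ (-(η / 2)) with hθ₁
  set θ₂ := q ^ (-(c * η / 2)) with hθ₂
  have hθ₁1 : θ₁ < 1 := Real.rpow_lt_one_of_one_lt_of_neg hq (by linarith)
  have hθ₂1 : θ₂ < 1 := Real.rpow_lt_one_of_one_lt_of_neg hq (by
    have : 0 < c * η := by positivity
    linarith)
  have hθ₁0 : 0 < θ₁ := by positivity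
  have hθ₂0 : 0 < θ₂ := by positivity
  have hab₁ : |θ₁| < 1 := by rwa [abs_of_pos hθ₁0]
  have hab₂ : |θ₂| < 1 := by rwa [abs_of_pos hθ₂0]
  have ht₁ : Filter.Tendsto (fun n : ℕ => 4 * q * θ₁ ^ n) Filter.atTop (nhds 0) := by
    simpa using (tendsto_pow_atTop_nhds_zero_of_abs_lt_one hab₁).const_mul (4 * q)
  have ht₂ : Filter.Tendsto (fun n : ℕ => (n : ℝ) ^ 2 * θ₂ ^ n) Filter.atTop (nhds 0) :=
    tendsto_pow_const_mul_const_pow_of_abs_lt_one 2 hab₂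
  have ht₃ : Filter.Tendsto (fun n : ℕ => n * (4 * q * θ₁ ^ n) + n * ((n : ℝ) ^ 2 * θ₂ ^ n))
      Filter.atTop (nhds 0) := by
    have h1 := (tendsto_pow_const_mul_const_pow_of_abs_lt_one 1 hab₁).const_mul (4 * q)
    have h2 := tendsto_pow_const_mul_const_pow_of_abs_lt_one 3 hab₂
    have h3 := h1.add h2
    rw [mul_zero, add_zero] at h3
    refine h3.congr fun n => ?_
    ring
  -- The first bound serves large W; the second absorbs the loss factor 1 + 1/α in the small case.
  refine ⟨min (α ^ 2 / 2) (1 / 2 / (1 + 1 / α)), by positivity, _, ht₃, ?_⟩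
  filter_upwards [ht₁.eventually_le_const one_pos, ht₂.eventually_le_const one_pos,
    Filter.eventually_gt_atTop 0] with n hb₁ hb₂ hn k₁ k₂ hk₁ hk₂ hkη₁ hkη₂
  set m := ⌊α * n⌋₊ with hm
  set Λ : ℝ := (numLight F n m : ℝ) with hΛ
  have hΛn : Λ ≤ q ^ (ε * n) := hL n
  have hΛ1 : 1 ≤ Λ := by rw [hΛ]; exact_mod_cast one_le_numLight F n m
  have hn0 : (0 : ℝ) < n := by exact_mod_cast hn
  have hinv : ∀ k : ℕ, η * n ≤ (n - k : ℕ) → (q ^ (n - k))⁻¹ ≤ q ^ (-(η * n)) := fun k hk => by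
    rw [Real.rpow_neg hq0.le, ← Real.rpow_natCast]
    exact inv_anti₀ (by positivity) (Real.rpow_le_rpow_of_exponent_le hq.le hk)
  have hΛ3 : Λ ^ 3 ≤ q ^ (3 * ε * n) := by
    calc Λ ^ 3 ≤ (q ^ (ε * n)) ^ 3 := pow_le_pow_left₀ (by positivity) hΛn 3
      _ = q ^ (3 * ε * n) := by
        rw [← Real.rpow_natCast, ← Real.rpow_mul hq0.le]
        congr 1
        push_cast
        ring
  have hbound₁ : 4 * Λ ^ 3 * q ^ ⌈c * n⌉₊ * (q ^ (n - k₁))⁻¹ ≤ 4 * q * θ₁ ^ n := by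
    have h1 : q ^ ⌈c * n⌉₊ ≤ q ^ (c * n + 1) := by
      rw [← Real.rpow_natCast]
      exact Real.rpow_le_rpow_of_exponent_le hq.le (Nat.ceil_lt_add_one (by positivity)).le
    calc 4 * Λ ^ 3 * q ^ ⌈c * n⌉₊ * (q ^ (n - k₁))⁻¹
        ≤ 4 * q ^ (3 * ε * n) * q ^ (c * n + 1) * q ^ (-(η * n)) := by
          gcongr
          exact hinv k₁ hkη₁
      _ = 4 * q ^ (1 + (3 * ε + c - η) * n) := by
          rw [mul_assoc, mul_assoc, ← Real.rpow_add hq0, ← Real.rpow_add hq0]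
          congr 2
          ring
      _ ≤ 4 * q ^ (1 + -(η / 2) * n) := by
          gcongr 4 * ?_
          refine Real.rpow_le_rpow_of_exponent_le hq.le ?_
          gcongr
          rw [hε, hc]
          nlinarith
      _ = 4 * q * θ₁ ^ n := by
          rw [Real.rpow_add hq0, Real.rpow_one, hθ₁, ← Real.rpow_natCast (q ^ _),
            ← Real.rpow_mul hq0.le]
          ring
  have hd : Λ * (q ^ (n - k₂))⁻¹ ≤ q ^ ((ε - η) * n) := by
    calc Λ * (q ^ (n - k₂))⁻¹ ≤ q ^ (ε * n) * q ^ (-(η * n)) := by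
          gcongr
          exact hinv k₂ hkη₂
      _ = q ^ ((ε - η) * n) := by
          rw [← Real.rpow_add hq0]
          congr 1
          ring
  have hεη : ε ≤ η / 8 := by
    rw [hε, hc]
    nlinarith
  have hd1 : Λ * (q ^ (n - k₂))⁻¹ ≤ 1 :=
    hd.trans (Real.rpow_le_one_of_one_le_of_nonpos hq.le
      (mul_nonpos_of_nonpos_of_nonneg (by linarith) hn0.le))
  have hbound₂ : (n : ℝ) ^ 2 * Λ ^ 3 * (Λ * (q ^ (n - k₂))⁻¹) ^ c ≤ (n : ℝ) ^ 2 * θ₂ ^ n := by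
    calc (n : ℝ) ^ 2 * Λ ^ 3 * (Λ * (q ^ (n - k₂))⁻¹) ^ c
        ≤ (n : ℝ) ^ 2 * q ^ (3 * ε * n) * (q ^ ((ε - η) * n)) ^ c := by gcongr
      _ = (n : ℝ) ^ 2 * q ^ ((3 * ε + (ε - η) * c) * n) := by
          rw [mul_assoc, ← Real.rpow_mul hq0.le, ← Real.rpow_add hq0]
          congr 2
          ring
      _ ≤ (n : ℝ) ^ 2 * q ^ (-(c * η / 2) * n) := by
          gcongr (n : ℝ) ^ 2 * ?_
          refine Real.rpow_le_rpow_of_exponent_le hq.le ?_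
          gcongr
          have : ε * c ≤ η / 8 * c := by gcongr
          rw [sub_mul]
          linarith [hε]
      _ = (n : ℝ) ^ 2 * θ₂ ^ n := by
          rw [hθ₂, ← Real.rpow_natCast (q ^ _), ← Real.rpow_mul hq0.le]
  have hcount₁ := ncard_not_spreadsLight_le (F := F) (m := m) hk₁ (c := c) (by linarith) hc0.le
    (Nat.le_ceil _) (hbound₁.trans hb₁)
  have hcount₂ := fun (C₁ : Submodule F (Fin n → F)) (h : SpreadsLight m c C₁) =>
    ncard_hasLightSum_le hk₂ h hd1 (hbound₂.trans hb₂)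
  set ρ := min (α ^ 2 / 2) (1 / 2 / (1 + 1 / α)) with hρ
  have hρ' : ρ * (1 + 1 / α) ≤ 1 / 2 := by
    have : ρ ≤ 1 / 2 / (1 + 1 / α) := min_le_right _ _
    rwa [le_div_iff₀ (by positivity)] at this
  set A := {C | C ∈ Gr F n k₁ ∧ ¬ SpreadsLight m c C}
  set S := {p : Submodule F (Fin n → F) × Submodule F (Fin n → F) | p.1 ∈ Gr F n k₁ ∧
    p.2 ∈ Gr F n k₂ ∧ SpreadsLight m c p.1 ∧ HasLightSum m p.1 p.2}
  have hsub : {C : Submodule F (Fin n → F) × Submodule F (Fin n → F) |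
      C ∈ Gr F n k₁ ×ˢ Gr F n k₂ ∧ ¬ IsRobustlyTestable ρ C.1 C.2} ⊆
      (A ×ˢ Gr F n k₂) ∪ S := by
    rintro ⟨C₁, C₂⟩ ⟨⟨h₁, h₂⟩, hrob⟩
    by_cases hs : SpreadsLight m c C₁
    · refine Or.inr ⟨h₁, h₂, hs, ?_⟩
      by_contra hns
      exact hrob (isRobustlyTestable_of_spreadsLight hn hα hc0 (by positivity) (min_le_left _ _)
        hρ' hs hns)
    · exact Or.inl ⟨⟨h₁, hs⟩, h₂⟩
  have hle : ({C : Submodule F (Fin n → F) × Submodule F (Fin n → F) |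
      C ∈ Gr F n k₁ ×ˢ Gr F n k₂ ∧ ¬ IsRobustlyTestable ρ C.1 C.2}.ncard : ℝ) ≤
      A.ncard * (Gr F n k₂).ncard + S.ncard := by
    have h1 := (Set.ncard_le_ncard hsub (Set.toFinite _)).trans (Set.ncard_union_le _ _)
    rw [Set.ncard_prod] at h1
    exact_mod_cast h1
  have hS : (S.ncard : ℝ) ≤ (Gr F n k₁).ncard *
      (n * ((n : ℝ) ^ 2 * θ₂ ^ n * (Gr F n k₂).ncard)) := by
    refine ncard_le_mul_of_fiber_le (fun p hp => hp.1) fun C₁ hC₁ => ?_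
    by_cases hs : SpreadsLight m c C₁
    · refine le_trans (Nat.cast_le.2 (Set.ncard_le_ncard
        (t := {C | C ∈ Gr F n k₂ ∧ HasLightSum m C₁ C}) (fun C₂ hC₂ => ⟨hC₂.2.1, hC₂.2.2.2⟩) (Set.toFinite _))) ((hcount₂ C₁ hs).trans ?_)
      gcongr
    · have : {b | (C₁, b) ∈ S} = ∅ := Set.eq_empty_of_forall_notMem fun b hb => hs hb.2.2.1
      rw [this, Set.ncard_empty, Nat.cast_zero]
      positivity
  have hA : (A.ncard : ℝ) ≤ n * (4 * q * θ₁ ^ n * (Gr F n k₁).ncard) :=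
    hcount₁.trans (by gcongr)
  calc _ ≤ (A.ncard : ℝ) * (Gr F n k₂).ncard + S.ncard := hle
    _ ≤ n * (4 * q * θ₁ ^ n * (Gr F n k₁).ncard) * (Gr F n k₂).ncard +
        (Gr F n k₁).ncard * (n * ((n : ℝ) ^ 2 * θ₂ ^ n * (Gr F n k₂).ncard)) := by gcongr
    _ = _ := by ring

theorem corollary1 (F : Type*) [Field F] [Finite F] (R₁ R₂ : ℝ)
    (hR₁ : R₁ ∈ Set.Ioo (0 : ℝ) 1) (hR₂ : R₂ ∈ Set.Ioo (0 : ℝ) 1) :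
    ∃ ρ : ℝ, 0 < ρ ∧ ∀ k₁ k₂ : ℕ → ℕ,
      Filter.Tendsto (fun n => (k₁ n : ℝ) / n) Filter.atTop (nhds R₁) →
      Filter.Tendsto (fun n => (k₂ n : ℝ) / n) Filter.atTop (nhds R₂) →
      Filter.Tendsto
        (fun n : ℕ =>
          ProbabilityTheory.uniformOn (Gr F n (k₁ n) ×ˢ Gr F n (k₂ n))
            {C : Submodule F (Fin n → F) × Submodule F (Fin n → F) |
              IsRobustlyTestable ρ C.1 C.2 ∧
                IsRobustlyTestable ρ (dualCode C.1) (dualCode C.2)})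
        Filter.atTop (nhds 1) := by
  -- Below the rates and the co-rates alike, so that both the codes and their duals eventually have
  -- codimension at least ηn.
  obtain ⟨η, hη, hηR₁, hηR₁', hηR₂, hηR₂'⟩ : ∃ η : ℝ, 0 < η ∧ η < R₁ ∧ η < 1 - R₁ ∧ η < R₂ ∧
      η < 1 - R₂ := by
    obtain ⟨η, hη0, hη⟩ := exists_between
      (show 0 < min (min R₁ (1 - R₁)) (min R₂ (1 - R₂)) from
        lt_min (lt_min hR₁.1 (sub_pos.2 hR₁.2)) (lt_min hR₂.1 (sub_pos.2 hR₂.2)))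
    simp only [lt_min_iff] at hη
    exact ⟨η, hη0, hη.1.1, hη.1.2, hη.2.1, hη.2.2⟩
  obtain ⟨ρ, hρ, δ, hδ, hmain⟩ := exists_ncard_not_isRobustlyTestable_le F hη
    (hηR₁.trans hR₁.2).le
  refine ⟨ρ, hρ, fun k₁ k₂ hk₁ hk₂ => ?_⟩
  have key : ∀ (k : ℕ → ℕ) (R : ℝ), η < R → η < 1 - R →
      Filter.Tendsto (fun n => (k n : ℝ) / n) Filter.atTop (nhds R) →
      ∀ᶠ n : ℕ in Filter.atTop, k n ≤ n ∧ η * n ≤ k n ∧ η * n ≤ (n - k n : ℕ) := by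
    intro k R h1 h2 hk
    filter_upwards [hk.eventually_const_le h1, hk.eventually_le_const (lt_sub_comm.1 h2),
      Filter.eventually_gt_atTop 0] with n ha hb hn
    have hn0 : (0 : ℝ) < n := by exact_mod_cast hn
    rw [le_div_iff₀ hn0] at ha
    rw [div_le_iff₀ hn0] at hb
    have hkn : k n ≤ n := by
      have : (k n : ℝ) ≤ n := by nlinarith
      exact_mod_cast this
    refine ⟨hkn, ha, ?_⟩
    rw [Nat.cast_sub hkn]
    linarith
  -- The failure bound δ is paid twice, once for the pair and once for its dual.
  have hlow : Filter.Tendsto (fun n => ENNReal.ofReal (1 - 2 * δ n)) Filter.atTop (nhds 1) := by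
    have : Filter.Tendsto (fun n => 1 - 2 * δ n) Filter.atTop (nhds (1 - 2 * 0)) :=
      tendsto_const_nhds.sub (hδ.const_mul 2)
    simpa using ENNReal.tendsto_ofReal this
  refine tendsto_of_tendsto_of_tendsto_of_le_of_le' hlow tendsto_const_nhds ?_ ?_
  · filter_upwards [hmain, key k₁ R₁ hηR₁ hηR₁' hk₁, key k₂ R₂ hηR₂ hηR₂' hk₂]
      with n hn ⟨h₁, h₁', h₁''⟩ ⟨h₂, h₂', h₂''⟩
    refine ofReal_one_sub_le_uniformOn ((gr_nonempty F h₁).prod (gr_nonempty F h₂)) ?_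
    have e1 := hn (k₁ n) (k₂ n) h₁ h₂ h₁'' h₂''
    have e2 := hn (n - k₁ n) (n - k₂ n) (Nat.sub_le _ _) (Nat.sub_le _ _)
      (by rwa [Nat.sub_sub_self h₁]) (by rwa [Nat.sub_sub_self h₂])
    rw [ncard_gr_sub h₁, ncard_gr_sub h₂] at e2
    set S₁ := {C : Submodule F (Fin n → F) × Submodule F (Fin n → F) |
      C ∈ Gr F n (k₁ n) ×ˢ Gr F n (k₂ n) ∧ ¬ IsRobustlyTestable ρ C.1 C.2}
    set S₂ := {C : Submodule F (Fin n → F) × Submodule F (Fin n → F) |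
      C ∈ Gr F n (n - k₁ n) ×ˢ Gr F n (n - k₂ n) ∧ ¬ IsRobustlyTestable ρ C.1 C.2}
    have hsub : (Gr F n (k₁ n) ×ˢ Gr F n (k₂ n)) \
        {C : Submodule F (Fin n → F) × Submodule F (Fin n → F) | IsRobustlyTestable ρ C.1 C.2 ∧
          IsRobustlyTestable ρ (dualCode C.1) (dualCode C.2)} ⊆
        S₁ ∪ Prod.map dualCode dualCode '' S₂ := by
      rintro ⟨C₁, C₂⟩ ⟨hC, hnot⟩
      by_cases hr : IsRobustlyTestable ρ C₁ C₂
      · refine Or.inr ⟨(dualCode C₁, dualCode C₂),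
          ⟨⟨dualCode_mem_gr hC.1, dualCode_mem_gr hC.2⟩, fun h => hnot ⟨hr, h⟩⟩, ?_⟩
        simp [dualCode_dualCode]
      · exact Or.inl ⟨hC, hr⟩
    have h3 := (Set.ncard_le_ncard hsub (Set.toFinite _)).trans ((Set.ncard_union_le _ _).trans
      (Nat.add_le_add_left (Set.ncard_image_le (Set.toFinite S₂)) _))
    have h4 : (((Gr F n (k₁ n) ×ˢ Gr F n (k₂ n)) \
        {C : Submodule F (Fin n → F) × Submodule F (Fin n → F) | IsRobustlyTestable ρ C.1 C.2 ∧
          IsRobustlyTestable ρ (dualCode C.1) (dualCode C.2)}).ncard : ℝ) ≤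
        S₁.ncard + S₂.ncard := by exact_mod_cast h3
    rw [Set.ncard_prod]
    push_cast
    linarith
  · filter_upwards [key k₁ R₁ hηR₁ hηR₁' hk₁, key k₂ R₂ hηR₂ hηR₂' hk₂] with n h₁ h₂
    have := ProbabilityTheory.isProbabilityMeasure_uniformOn
      (Set.toFinite (Gr F n (k₁ n) ×ˢ Gr F n (k₂ n)))
      ((gr_nonempty F h₁.1).prod (gr_nonempty F h₂.1))
    exact MeasureTheory.prob_le_one
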